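/- Let $f:U'\to U$ be a Douady–Hubbard quadratic-like map (a double branched covering between topological disks, $U'$ relatively compact in $U$) with critical point $0$, with connected filled Julia set $K(f)$ and with both fixed points repelling. Fix a topological conjugacy $\varphi$ from a neighborhood of $K(f)$ in $U'$ to a neighborhood of the filled Julia set of a polynomial $P_c:z\mapsto z^2+c$, carrying $K(f)$ onto that filled Julia set; external rays and equipotentials of $f$ near $K(f)$ are the $\varphi$-preimages of those of $P_c$. Let $\alpha$ be the dividing fixed point of $f$ (so $K(f)\setminus\{\alpha\}$ is disconnected), and let $E$ be an equipotential so close to $K(f)$ that the disks bounded by $E$ and by $fE$ lie in the domain of $\varphi$. The puzzle pieces of depth $0$ are the closed disks into which the disk bounded by $E$ is cut by the external rays landing at $\alpha$. The puzzle pieces of depth $n$ are the closures of the connected components of the sets $f^{-n}(\operatorname{int}Y)$, where $Y$ is a puzzle piece of depth $0$. Let $V$ be a critical puzzle piece of some depth $n$, that is, $0\in\operatorname{int}V$. Let $A_Vf$ be the first return map to $\operatorname{int}V$: it sends a point $z\in\operatorname{int}V$ whose orbit returns to $\operatorname{int} V$ to $f^{l(z)}z$, where $l(z)>0$ is the first moment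 with $f^{l(z)}z\in\operatorname{int}V$. Let $\operatorname{int}V_i$ denote the connected components of its domain of definition, and $V_i$ their closures. Then: 1. Each $V_i$ is a puzzle piece contained in $V$. The first return time is a constant $l_i>0$ on $\operatorname{int}V_i$, the depth of $V_i$ is $n+l_i$, and $f^{l_i}(V_i)=V$. 2. If $0\notin\operatorname{int}V_i$, then $A_Vf$ maps $\operatorname{int}V_i$ univalently (holomorphically and bijectively) onto $\operatorname{int}V$. 3. If $0\in\operatorname{int}V_i$ (this piece, which exists if the critical point returns to $\operatorname{int}V$, is denoted by $V_0$), then $A_Vf:\operatorname{int}V_0\to\operatorname{int}V$ is a double branched covering, with critical point $0$. 4. Consequently $A_Vf:\bigcup_i\operatorname{int}V_i\to\operatorname{int}V$ is Bernoulli with range $\operatorname{int}V$: the $\operatorname{int} V_i$ form a finite or countable family of pairwise disjoint topological disks contained in $\operatorname{int}V$, the restriction of $A_Vf$ to each of them is a branched covering onto its image, this image contains $\operatorname{int} V$, and it contains every $\operatorname{int} V_j$ that it meets. On the union of the $\operatorname{int}V_i$ with $0\notin \operatorname{int}V_i$ it is standard Bernoulli, that is, the restrictions are moreover one-to-one. 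-/

import Mathlib

open Set Filter Topology

noncomputable section

namespace Puzzle

/-- A topological disk: a simply connected region of the plane, i.e. a nonempty connected open set
whose complement in the Riemann sphere is connected. -/
structure IsTopologicalDisk (D : Set ℂ) : Prop where
  isOpen : IsOpen D
  isConnected : IsConnected D
  compl : IsConnected (((↑) '' D : Set (OnePoint ℂ))ᶜ)

/-- `g` maps `A` univalently onto `B`. -/
structure IsUnivalentOnto (g : ℂ → ℂ) (A B : Set ℂ) : Prop where
  holo : DifferentiableOn ℂ g A
  bij : BijOn g A B

/-- `g : A → B` is a (finite) branched covering between plane regions: a proper holomorphic map of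
`A` onto `B`. -/
structure IsBranchedCovering (g : ℂ → ℂ) (A B : Set ℂ) : Prop where
  holo : DifferentiableOn ℂ g A
  mapsTo : MapsTo g A B
  surjOn : SurjOn g A B
  proper : ∀ C ⊆ B, IsCompact C → IsCompact (A ∩ g ⁻¹' C)

/-- `g : A → B` is a double branched covering with critical point `z₀`: `z₀` is the only critical
point, it is the only preimage of the critical value, and every other point of `B` has exactly two
preimages in `A`. -/
structure IsDoubleBranchedCovering (g : ℂ → ℂ) (A B : Set ℂ) (z₀ : ℂ) : Prop
    extends IsBranchedCovering g A B where
  mem : z₀ ∈ A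
  critical : ∀ z ∈ A, deriv g z = 0 ↔ z = z₀
  fiber_critical : A ∩ g ⁻¹' {g z₀} = {z₀}
  fiber : ∀ w ∈ B, w ≠ g z₀ → (A ∩ g ⁻¹' {w}).ncard = 2

/-! ### Quadratic polynomials: potential, Böttcher function, external rays -/

/-- The quadratic polynomial `z ↦ z ^ 2 + c`. -/
def quad (c z : ℂ) : ℂ := z ^ 2 + c

/-- The filled Julia set of `quad c`: the complement of the basin of infinity. -/
def quadFilledJulia (c : ℂ) : Set ℂ :=
  {z | ¬ Tendsto (fun n : ℕ => (quad c)^[n] z) atTop (cocompact ℂ)}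

/-- The Green function (potential) of `quad c`. It vanishes on the filled Julia set and equals
`log |B|` outside of it, `B` the Böttcher function; so the equipotentials are its level curves. -/
def green (c z : ℂ) : ℝ :=
  limUnder atTop fun n : ℕ => Real.posLog ‖(quad c)^[n] z‖ / 2 ^ n

/-- `B` is the Böttcher function of `quad c` on the basin of infinity (for connected filled Julia
set): the conformal isomorphism onto the exterior of the unit disk, tangent to the identity at
infinity, which conjugates `quad c` to squaring. It is unique. -/
structure IsBottcher (c : ℂ) (B : ℂ → ℂ) : Prop where
  holo : DifferentiableOn ℂ B (quadFilledJulia c)ᶜ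
  bij : BijOn B (quadFilledJulia c)ᶜ {w | 1 < ‖w‖}
  conj : ∀ z ∈ (quadFilledJulia c)ᶜ, B (quad c z) = B z ^ 2
  tangent : Tendsto (fun z => B z / z) (cocompact ℂ) (𝓝 1)

/-- The external ray of angle `θ` (in turns): the preimage of the straight ray under `B`. -/
def externalRay (c : ℂ) (B : ℂ → ℂ) (θ : ℝ) : Set ℂ :=
  {z | z ∉ quadFilledJulia c ∧
    ∃ r : ℝ, 1 < r ∧ B z = r * Complex.exp (2 * Real.pi * θ * Complex.I)}

/-- The external ray of angle `θ` lands at `a`: its points tend to `a` as the potential tends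
to zero. -/
def RayLandsAt (c : ℂ) (B : ℂ → ℂ) (θ : ℝ) (a : ℂ) : Prop :=
  ∀ ε > 0, ∃ δ > 0, ∀ z ∈ externalRay c B θ, green c z < δ → dist z a < ε

/-- The union of the external rays of `quad c` that land at `a`. -/
def raysLandingAt (c a : ℂ) : Set ℂ :=
  {z | ∃ (B : ℂ → ℂ) (θ : ℝ), IsBottcher c B ∧ RayLandsAt c B θ a ∧ z ∈ externalRay c B θ}

/-! ### Quadratic-like maps -/

/-- `f : U' → U` is a Douady–Hubbard quadratic-like map with critical point at the origin. -/
structure IsQuadraticLike (f : ℂ → ℂ) (U' U : Set ℂ) : Prop where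
  disk_dom : IsTopologicalDisk U'
  disk_range : IsTopologicalDisk U
  compact : IsCompact (closure U')
  subset : closure U' ⊆ U
  covering : IsDoubleBranchedCovering f U' U 0

/-- The filled Julia set of `f : U' → U`: the set of non-escaping points. -/
def filledJulia (f : ℂ → ℂ) (U' : Set ℂ) : Set ℂ := {z | ∀ n : ℕ, f^[n] z ∈ U'}

/-- Both fixed points of `f` (that is, all of them) are repelling. -/
def FixedPointsRepelling (f : ℂ → ℂ) (U' : Set ℂ) : Prop :=
  ∀ z ∈ U', f z = z → 1 < ‖deriv f z‖

/-- `α` is the dividing fixed point of `f`. -/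
structure IsDividingFixedPoint (f : ℂ → ℂ) (U' : Set ℂ) (α : ℂ) : Prop where
  mem : α ∈ filledJulia f U'
  fixed : f α = α
  dividing : ¬ IsPreconnected (filledJulia f U' \ {α})

/-- `φ` is a topological conjugacy between `f` and `quad c` near the filled Julia sets. External
rays and equipotentials of `f` are, near its filled Julia set, the preimages under `φ` of those of
`quad c`. -/
structure IsConjugacy (f : ℂ → ℂ) (U' : Set ℂ) (c : ℂ) (φ : OpenPartialHomeomorph ℂ ℂ) :
    Prop where
  source_subset : φ.source ⊆ U'
  filledJulia_subset : filledJulia f U' ⊆ φ.source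
  image : φ '' filledJulia f U' = quadFilledJulia c
  conj : ∀ z ∈ φ.source, f z ∈ φ.source → φ (f z) = quad c (φ z)

/-- The equipotential `E` of level `h` is so close to the filled Julia set that `E` and `f E`,
together with the disks that they bound, lie in the domain of the conjugacy. -/
structure IsAdmissibleLevel (f : ℂ → ℂ) (c : ℂ) (φ : OpenPartialHomeomorph ℂ ℂ) (h : ℝ) :
    Prop where
  pos : 0 < h
  subset_target : {w | green c w ≤ h} ⊆ φ.target
  image_mem : ∀ z ∈ φ.source, green c (φ z) ≤ h → f z ∈ φ.source

/-! ### The Yoccoz puzzle -/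

/-- The domain bounded by the equipotential of level `h`, cut along the external rays landing
at `α`. (The rays landing at `α` are finite in number; the closure adds their landing point.) -/
def cutDomain (c : ℂ) (φ : OpenPartialHomeomorph ℂ ℂ) (α : ℂ) (h : ℝ) : Set ℂ :=
  {z | z ∈ φ.source ∧ green c (φ z) < h ∧ φ z ∉ closure (raysLandingAt c (φ α))}

/-- The preimage `f⁻ⁿ S` under the partially defined map `f : U' → U`. -/
def iteratePreimage (f : ℂ → ℂ) (U' : Set ℂ) (n : ℕ) (S : Set ℂ) : Set ℂ :=
  {z | (∀ k < n, f^[k] z ∈ U') ∧ f^[n] z ∈ S}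

/-- `P` is a connected component of `S`. -/
def IsComponentOf (P S : Set ℂ) : Prop := ∃ z ∈ S, P = connectedComponentIn S z

/-- `P` is the interior of a puzzle piece of depth `n`. The puzzle pieces are closed disks; each of
them is represented here by its interior `P` and recovered as `closure P`. -/
def IsPuzzlePiece (f : ℂ → ℂ) (U' : Set ℂ) (c : ℂ) (φ : OpenPartialHomeomorph ℂ ℂ) (α : ℂ) (h : ℝ)
    (n : ℕ) (P : Set ℂ) : Prop :=
  IsComponentOf P (iteratePreimage f U' n (cutDomain c φ α h))

/-! ### First return maps -/

/-- The set of positive moments at which the orbit of `z` under `f : U' → U` is in `V`. -/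
def returnTimes (f : ℂ → ℂ) (U' V : Set ℂ) (z : ℂ) : Set ℕ :=
  {l | 0 < l ∧ (∀ k < l, f^[k] z ∈ U') ∧ f^[l] z ∈ V}

/-- The set of points of `V` that return to `V`: the domain of the first return map. -/
def returnSet (f : ℂ → ℂ) (U' V : Set ℂ) : Set ℂ := {z | z ∈ V ∧ (returnTimes f U' V z).Nonempty}

/-- The first return time to `V`. -/
def returnTime (f : ℂ → ℂ) (U' V : Set ℂ) (z : ℂ) : ℕ := sInf (returnTimes f U' V z)

/-- The first return map to `V`, meaningful on `returnSet f U' V`. -/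
def returnMap (f : ℂ → ℂ) (U' V : Set ℂ) (z : ℂ) : ℂ := f^[returnTime f U' V z] z

/-- `W` is a domain of the first return map to `V`. -/
def IsReturnDomain (f : ℂ → ℂ) (U' V W : Set ℂ) : Prop := IsComponentOf W (returnSet f U' V)

/-! ### Bernoulli maps -/

/-- `g : ⋃ Pᵢ → ℂ` is a Markov map; `F` is the (finite or countable) family of the disks `Pᵢ`. -/
structure IsMarkov (g : ℂ → ℂ) (F : Set (Set ℂ)) : Prop where
  countable : F.Countable
  disk : ∀ P ∈ F, IsTopologicalDisk P
  disjoint : F.PairwiseDisjoint id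
  covering : ∀ P ∈ F, IsBranchedCovering g P (g '' P)
  markov : ∀ P ∈ F, ∀ Q ∈ F, (g '' P ∩ Q).Nonempty → Q ⊆ g '' P

/-- A Bernoulli map with range `D`. -/
structure IsBernoulli (g : ℂ → ℂ) (F : Set (Set ℂ)) (D : Set ℂ) : Prop extends IsMarkov g F where
  range_subset : ∀ P ∈ F, D ⊆ g '' P
  subset_range : ∀ P ∈ F, P ⊆ D

/-- A standard Bernoulli map: all the restrictions are moreover one-to-one. -/
structure IsStandardBernoulli (g : ℂ → ℂ) (F : Set (Set ℂ)) (D : Set ℂ) : Prop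
    extends IsBernoulli g F D where
  injOn : ∀ P ∈ F, InjOn g P

end Puzzle

end

open Puzzle

namespace Puzzle

/-! ### Sets without holes -/

/-! Let D_m be the m-th preimage of the cut disk, so that the interiors of the puzzle pieces of
depth m are the components of D_m. Two facts carry the theorem.

Markov property: the rays landing at the fixed point form a forward invariant set and the map
doubles potentials, so D_(m+1) ⊆ D_m (`antitone_iteratePreimage`). Properness of f makes it carry
each component of D_(m+1) onto a component of D_m (`image_component`). If z ∈ V first returns at
time l, the component of D_(n+l) around z is therefore mapped onto V by f^l and is contained in V.
An earlier return of another of its points would, by nesting, be an earlier return of z. Hence the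
return time is constant there, and the components of the return set are exactly these pieces.

Degree: since 0 ∈ V, the images of the piece at times strictly between 0 and l avoid 0. On a piece
that avoids 0 the map f is injective (`injOn_component`), so f^l has the degree of its first factor:
one if the piece avoids 0, two otherwise.

The planar topology concerns simple connectivity. Absence of holes (`NoHoles`) is characterized by
the existence of continuous logarithms of z - a on compact subsets, for a outside the set. This
criterion transfers through the homeomorphism φ, which is how the disk bounded by the equipotential
of f inherits it from that of the polynomial. For the polynomial, that disk is exhausted by
preimages of round disks, each with an explicit conformal parametrization. Injectivity away from 0
is a logarithm argument as well: a failure would put a connected set, symmetric about 0, inside a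
hole-free set omitting 0, but log z does not exist on such a set. -/

/-- `G` has no holes: its complement in the Riemann sphere is connected. A hole of an open set is a
compact set that can be added to it without losing openness. -/
def NoHoles (G : Set ℂ) : Prop :=
  ∀ C : Set ℂ, IsCompact C → Disjoint C G → IsOpen (G ∪ C) → C = ∅

theorem IsTopologicalDisk.noHoles {D : Set ℂ} (hD : IsTopologicalDisk D) : NoHoles D := by
  intro C hC hdis hop
  by_contra hne
  have hpre := isPreconnected_closed_iff.1 hD.compl.isPreconnected
    (((↑) '' (D ∪ C) : Set (OnePoint ℂ))ᶜ) ((↑) '' C)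
    (by rw [isClosed_compl_iff, OnePoint.isOpen_image_coe]; exact hop)
    (OnePoint.isClosed_image_coe.2 ⟨hC.isClosed, hC⟩)
  have h1 := hpre ?_ ?_ ?_
  · obtain ⟨x, -, hx, y, hy, rfl⟩ := h1
    exact hx ⟨y, Or.inr hy, rfl⟩
  · intro x hx
    by_cases h : x ∈ ((↑) '' C : Set (OnePoint ℂ))
    · exact Or.inr h
    · left
      rw [image_union]
      rintro (h' | h')
      exacts [hx h', h h']
  · exact ⟨OnePoint.infty, OnePoint.infty_notMem_image_coe, OnePoint.infty_notMem_image_coe⟩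
  · obtain ⟨y, hy⟩ := nonempty_iff_ne_empty.2 hne
    refine ⟨y, ?_, y, hy, rfl⟩
    rintro ⟨z, hz, hzy⟩
    rw [OnePoint.coe_eq_coe] at hzy
    subst hzy
    exact disjoint_left.1 hdis hy hz

/-- In a splitting of the complement into two closed parts, a part that avoids infinity is compact
in the plane, and its union with `D` is the complement of the other part. It is thus a hole, hence
empty. -/
theorem NoHoles.isConnected_compl {D : Set ℂ} (hD : NoHoles D) (ho : IsOpen D) :
    IsConnected (((↑) '' D : Set (OnePoint ℂ))ᶜ) := by
  refine ⟨⟨OnePoint.infty, OnePoint.infty_notMem_image_coe⟩, ?_⟩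
  have hcl : IsClosed (((↑) '' D : Set (OnePoint ℂ))ᶜ) := by
    rw [isClosed_compl_iff, OnePoint.isOpen_image_coe]; exact ho
  -- a closed part that avoids infinity is empty
  have key : ∀ A B : Set (OnePoint ℂ), IsClosed A → IsClosed B →
      ((↑) '' D : Set (OnePoint ℂ))ᶜ ⊆ A ∪ B → OnePoint.infty ∉ A →
      ((((↑) '' D : Set (OnePoint ℂ))ᶜ) ∩ A).Nonempty →
      ((((↑) '' D : Set (OnePoint ℂ))ᶜ) ∩ (A ∩ B)).Nonempty := by
    intro A B hA hB hAB hinf hne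
    by_contra hemp
    rw [not_nonempty_iff_eq_empty] at hemp
    have hAc : IsClosed (A ∩ ((↑) '' D : Set (OnePoint ℂ))ᶜ) := hA.inter hcl
    have hinf' : OnePoint.infty ∉ A ∩ ((↑) '' D : Set (OnePoint ℂ))ᶜ := fun h => hinf h.1
    have hC := (OnePoint.isClosed_iff_of_notMem hinf').1 hAc
    have := hD ((↑) ⁻¹' (A ∩ ((↑) '' D : Set (OnePoint ℂ))ᶜ)) hC.2 ?_ ?_
    · obtain ⟨x, hx, hxA⟩ := hne
      induction x using OnePoint.rec with
      | infty => exact hinf hxA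
      | coe y =>
        have : y ∈ (∅ : Set ℂ) := by rw [← this]; exact ⟨hxA, hx⟩
        exact this
    · rw [disjoint_left]
      intro x hx hxD
      exact hx.2 ⟨x, hxD, rfl⟩
    · have : D ∪ (↑) ⁻¹' (A ∩ ((↑) '' D : Set (OnePoint ℂ))ᶜ) =
          (↑) ⁻¹' (B ∩ ((↑) '' D : Set (OnePoint ℂ))ᶜ)ᶜ := by
        ext x
        simp only [mem_union, mem_preimage, mem_inter_iff, mem_compl_iff]
        have hi : ((x : OnePoint ℂ) ∈ ((↑) '' D : Set (OnePoint ℂ))) ↔ x ∈ D :=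
          OnePoint.coe_injective.mem_set_image
        rw [hi]
        have h1 : x ∉ D → ((x : OnePoint ℂ) ∈ A ∨ (x : OnePoint ℂ) ∈ B) := by
          intro h
          exact hAB (by rw [mem_compl_iff, hi]; exact h)
        have h2 : x ∉ D → (x : OnePoint ℂ) ∈ A → (x : OnePoint ℂ) ∈ B → False := by
          intro h ha hb
          have : (x : OnePoint ℂ) ∈ (∅ : Set (OnePoint ℂ)) := by
            rw [← hemp]
            exact ⟨by rw [mem_compl_iff, hi]; exact h, ha, hb⟩
          exact this
        tauto
      rw [this]
      exact (hB.inter hcl).isOpen_compl.preimage OnePoint.continuous_coe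
  rw [isPreconnected_closed_iff]
  intro A B hA hB hAB hnA hnB
  by_cases hinfA : OnePoint.infty ∈ A
  · by_cases hinfB : OnePoint.infty ∈ B
    · exact ⟨OnePoint.infty, OnePoint.infty_notMem_image_coe, hinfA, hinfB⟩
    · rw [inter_comm A B]
      exact key B A hB hA (by rwa [union_comm]) hinfB hnB
  · exact key A B hA hB hAB hinfA hnA

theorem eq_empty_of_isCompact_of_isOpen {C : Set ℂ} (hC : IsCompact C) (ho : IsOpen C) :
    C = ∅ := by
  rcases isClopen_iff.1 ⟨hC.isClosed, ho⟩ with h | h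
  · exact h
  · exact absurd (h ▸ hC) (noncompact_univ ℂ)

theorem noHoles_univ : NoHoles univ := by
  intro C _ hd _
  simpa using hd

theorem noHoles_ball (R : ℝ) : NoHoles (Metric.ball (0 : ℂ) R) := by
  intro C hC hd ho
  by_contra hne
  -- A point of the hole farthest from the origin can be pushed slightly outward inside the open
  -- union; it leaves the ball, so it stays in the hole, against maximality.
  obtain ⟨a, ha, hmax⟩ := hC.exists_isMaxOn (nonempty_iff_ne_empty.2 hne)
    continuous_norm.continuousOn
  have haR : R ≤ ‖a‖ := by
    by_contra h
    exact disjoint_left.1 hd ha (by simpa using h)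
  have hev : ∀ᶠ t : ℝ in 𝓝 1, (t : ℂ) * a ∈ Metric.ball 0 R ∪ C := by
    have hc : ContinuousAt (fun t : ℝ => (t : ℂ) * a) 1 := by fun_prop
    exact hc.eventually_mem (ho.mem_nhds (by simpa using Or.inr ha))
  have ha0 : a ≠ 0 := by
    rintro rfl
    have hR : R ≤ 0 := by simpa using haR
    rw [Metric.ball_eq_empty.2 hR, empty_union] at ho
    exact hne (eq_empty_of_isCompact_of_isOpen hC ho)
  obtain ⟨t, ht, ht1⟩ := ((hev.filter_mono nhdsWithin_le_nhds).and
    (self_mem_nhdsWithin : ∀ᶠ t in 𝓝[>] (1 : ℝ), t ∈ Ioi 1)).exists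
  have hlt : ‖a‖ < ‖(t : ℂ) * a‖ := by
    rw [norm_mul, Complex.norm_real, Real.norm_of_nonneg (by linarith [show (1:ℝ) < t from ht1])]
    have := norm_pos_iff.2 ha0
    nlinarith [show (1:ℝ) < t from ht1]
  rcases ht with ht | ht
  · rw [mem_ball_zero_iff] at ht; linarith
  · exact absurd (hmax ht) (by simpa using hlt)

/-- Pulling back by an open map preserves the absence of holes. -/
theorem NoHoles.pullback {f : ℂ → ℂ} {U G : Set ℂ} (hU : NoHoles U) (hUo : IsOpen U)
    (hG : NoHoles G) (hGo : IsOpen G) (hf : ContinuousOn f U)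
    (hopen : ∀ O ⊆ U, IsOpen O → IsOpen (f '' O)) : NoHoles (U ∩ f ⁻¹' G) := by
  intro C hC hd ho
  have hCU : C ⊆ U := by
    -- The part of `C` outside `U` is a hole of `U`, so `C` lies in `U`. The image `f '' C` is then
    -- a hole of `G`, because `f` is open.
    rw [← sdiff_eq_empty]
    refine hU _ (hC.diff hUo) disjoint_sdiff_left ?_
    have : U ∪ C \ U = U ∪ (U ∩ f ⁻¹' G ∪ C) := by
      ext x; simp only [mem_union, Set.mem_sdiff, mem_inter_iff]; tauto
    rw [this]
    exact hUo.union ho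
  rw [← image_eq_empty (f := f)]
  refine hG _ (hC.image_of_continuousOn (hf.mono hCU)) ?_ ?_
  · rw [disjoint_left]
    rintro _ ⟨x, hx, rfl⟩ hxG
    exact disjoint_left.1 hd hx ⟨hCU hx, hxG⟩
  · have : G ∪ f '' C = G ∪ f '' (U ∩ f ⁻¹' G ∪ C) := by
      rw [image_union, ← union_assoc, union_eq_self_of_subset_right (s := G)
        (t := f '' (U ∩ f ⁻¹' G))]
      rintro _ ⟨x, hx, rfl⟩
      exact hx.2
    rw [this]
    exact hGo.union (hopen _ (union_subset inter_subset_left hCU) ho)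

theorem isOpen_diff_connectedComponentIn {D : Set ℂ} (ho : IsOpen D) (z : ℂ) :
    IsOpen (D \ connectedComponentIn D z) := by
  rw [isOpen_iff_mem_nhds]
  intro y hy
  filter_upwards [ho.connectedComponentIn.mem_nhds (mem_connectedComponentIn hy.1)] with x hx
  refine ⟨connectedComponentIn_subset _ _ hx, fun hxz => hy.2 ?_⟩
  rw [connectedComponentIn_eq hxz, ← connectedComponentIn_eq hx]
  exact mem_connectedComponentIn hy.1

/-- A hole of a component lies in `D`, since `D` has no holes. Removing the component, which is
relatively closed in `D`, leaves the hole open as well as compact, hence empty. -/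
theorem NoHoles.connectedComponentIn {D : Set ℂ} (hD : NoHoles D) (ho : IsOpen D) (z : ℂ) :
    NoHoles (connectedComponentIn D z) := by
  intro C hC hd hoC
  set P := _root_.connectedComponentIn D z
  have hPD : P ⊆ D := connectedComponentIn_subset _ _
  have hCD : C ⊆ D := by
    rw [← sdiff_eq_empty]
    refine hD _ (hC.diff ho) disjoint_sdiff_left ?_
    have : D ∪ C \ D = D ∪ (P ∪ C) := by
      ext x; simp only [mem_union, Set.mem_sdiff]
      have := @hPD x
      tauto
    rw [this]
    exact ho.union hoC
  refine eq_empty_of_isCompact_of_isOpen hC ?_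
  have : C = (P ∪ C) ∩ (D \ P) := by
    ext x
    have h1 := @hCD x
    have h2 : x ∈ C → x ∉ P := fun h => disjoint_left.1 hd h
    simp only [mem_inter_iff, mem_union, Set.mem_sdiff]
    tauto
  rw [this]
  exact hoC.inter (isOpen_diff_connectedComponentIn ho z)

/-! ### Continuous logarithms -/

/-- `F` has a continuous logarithm on `K`. -/
def HasLogOn (F : ℂ → ℂ) (K : Set ℂ) : Prop :=
  ∃ L : ℂ → ℂ, ContinuousOn L K ∧ ∀ z ∈ K, Complex.exp (L z) = F z

theorem HasLogOn.mono {F : ℂ → ℂ} {K K' : Set ℂ} (h : HasLogOn F K) (hK : K' ⊆ K) :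
    HasLogOn F K' :=
  let ⟨L, hL, h⟩ := h
  ⟨L, hL.mono hK, fun z hz => h z (hK hz)⟩

/-- The identity has no continuous logarithm on a connected set that is symmetric about the
origin. -/
theorem not_hasLogOn_id_of_symmetric {K : Set ℂ} (hK : IsConnected K) (hsymm : ∀ z ∈ K, -z ∈ K) :
    ¬ HasLogOn id K := by
  rintro ⟨L, hL, hexp⟩
  have hne : ∀ z ∈ K, z ≠ 0 := fun z hz => by
    have := hexp z hz
    rw [id] at this
    rw [← this]; exact Complex.exp_ne_zero _
  obtain ⟨z₀, hz₀⟩ := hK.nonempty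
  have hd : ContinuousOn (fun z => ((L z - L (-z)) / (Real.pi * Complex.I)).re) K := by
    have : ContinuousOn (fun z => L (-z)) K := hL.comp continuousOn_neg hsymm
    exact Complex.continuous_re.comp_continuousOn ((hL.sub this).div_const _)
  -- The difference L(z) - L(-z) is an odd multiple of πi and changes sign under z ↦ -z. By
  -- connectedness it would vanish somewhere, but 0 is not odd.
  have hint : ∀ z ∈ K, ∃ m : ℤ, L z - L (-z) = (2 * m + 1) * (Real.pi * Complex.I) := by
    intro z hz
    have : Complex.exp (L z) = Complex.exp (L (-z) + Real.pi * Complex.I) := by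
      rw [Complex.exp_add, Complex.exp_pi_mul_I, hexp z hz, hexp _ (hsymm z hz)]; simp
    obtain ⟨m, hm⟩ := Complex.exp_eq_exp_iff_exists_int.1 this
    exact ⟨m, by rw [hm]; ring⟩
  have hpi : (Real.pi * Complex.I : ℂ) ≠ 0 := by simp [Real.pi_ne_zero]
  have hval : ∀ z ∈ K, ∃ m : ℤ, ((L z - L (-z)) / (Real.pi * Complex.I)).re = 2 * m + 1 := by
    intro z hz
    obtain ⟨m, hm⟩ := hint z hz
    refine ⟨m, ?_⟩
    rw [hm, mul_div_cancel_right₀ _ hpi]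
    simp
  obtain ⟨m, hm⟩ := hval z₀ hz₀
  have hm' : ((L (-z₀) - L (- -z₀)) / (Real.pi * Complex.I)).re = -(2 * m + 1) := by
    rw [neg_neg, ← neg_sub, neg_div, Complex.neg_re, hm]
  have hpc := hK.isPreconnected.image _ hd
  -- a value strictly between two odd integers would be attained
  have hIcc := hpc.ordConnected
  have h0 : (0 : ℝ) ∈ (fun z => ((L z - L (-z)) / (Real.pi * Complex.I)).re) '' K := by
    rcases le_total (0 : ℝ) (2 * m + 1) with h | h
    · exact hIcc.out ⟨_, hsymm _ hz₀, hm'⟩ ⟨_, hz₀, hm⟩ ⟨by linarith, h⟩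
    · exact hIcc.out ⟨_, hz₀, hm⟩ ⟨_, hsymm _ hz₀, hm'⟩ ⟨h, by linarith⟩
  obtain ⟨z, hz, hz0⟩ := h0
  obtain ⟨k, hk⟩ := hval z hz
  simp only at hz0
  rw [hz0] at hk
  have : (2 * k + 1 : ℤ) = 0 := by exact_mod_cast hk.symm
  omega

/-- The quotient (z - b') / (z - b) stays within distance less than 1 of 1, so its principal
logarithm is continuous and corrects one logarithm into the other. -/
theorem hasLogOn_sub_of_near {K : Set ℂ} {b b' : ℂ} (hlt : ∀ z ∈ K, ‖b' - b‖ < ‖z - b‖) :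
    HasLogOn (fun z => z - b) K ↔ HasLogOn (fun z => z - b') K := by
  have hne : ∀ z ∈ K, z - b ≠ 0 := fun z hz h => by
    have := hlt z hz
    rw [h, norm_zero] at this
    linarith [norm_nonneg (b' - b)]
  have hslit : ∀ z ∈ K, (z - b') / (z - b) ∈ Complex.slitPlane := by
    intro z hz
    have : (z - b') / (z - b) = 1 + (b - b') / (z - b) := by
      have := hne z hz
      field_simp; ring
    rw [this]
    apply Complex.mem_slitPlane_of_norm_lt_one
    rw [norm_div, div_lt_one (norm_pos_iff.2 (hne z hz)), norm_sub_rev]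
    exact hlt z hz
  have hc : ContinuousOn (fun z => Complex.log ((z - b') / (z - b))) K := by
    refine ContinuousOn.clog ?_ hslit
    exact ContinuousOn.div (by fun_prop) (by fun_prop) hne
  have hexp : ∀ z ∈ K, Complex.exp (Complex.log ((z - b') / (z - b))) = (z - b') / (z - b) :=
    fun z hz => Complex.exp_log (Complex.slitPlane_ne_zero (hslit z hz))
  constructor
  · rintro ⟨L, hL, h⟩
    refine ⟨_, hL.add hc, fun z hz => ?_⟩
    rw [Pi.add_apply, Complex.exp_add, h z hz, hexp z hz, mul_div_cancel₀ _ (hne z hz)]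
  · rintro ⟨L, hL, h⟩
    refine ⟨_, hL.sub hc, fun z hz => ?_⟩
    rw [Pi.sub_apply, Complex.exp_sub, h z hz, hexp z hz]
    have h1 := hne z hz
    have h2 := Complex.slitPlane_ne_zero (hslit z hz)
    have h3 : z - b' ≠ 0 := fun h => h2 (by rw [h, zero_div])
    field_simp

theorem hasLogOn_sub_of_far {K : Set ℂ} {b : ℂ} (hlt : ∀ z ∈ K, ‖z‖ < ‖b‖) :
    HasLogOn (fun z => z - b) K := by
  rcases K.eq_empty_or_nonempty with rfl | ⟨z₀, hz₀⟩
  · exact ⟨fun _ => 0, continuousOn_empty _, by simp⟩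
  have hb : b ≠ 0 := norm_pos_iff.1 ((norm_nonneg _).trans_lt (hlt z₀ hz₀))
  have hslit : ∀ z ∈ K, 1 + -z / b ∈ Complex.slitPlane := by
    intro z hz
    apply Complex.mem_slitPlane_of_norm_lt_one
    rw [norm_div, norm_neg, div_lt_one (norm_pos_iff.2 hb)]
    exact hlt z hz
  refine ⟨fun z => Complex.log (-b) + Complex.log (1 + -z / b), ?_, fun z hz => ?_⟩
  · exact continuousOn_const.add (ContinuousOn.clog (by fun_prop) hslit)
  · rw [Complex.exp_add, Complex.exp_log (neg_ne_zero.2 hb),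
      Complex.exp_log (Complex.slitPlane_ne_zero (hslit z hz))]
    field_simp
    ring

/-- Existence of a logarithm of z - b is locally constant in b off `K`. The predicate `p` covers
existence and nonexistence at once (`id` and `Not`). -/
theorem isOpen_setOf_hasLogOn_iff {K : Set ℂ} (hK : IsCompact K) (p : Prop → Prop) :
    IsOpen {b | b ∉ K ∧ p (HasLogOn (fun z => z - b) K)} := by
  rw [Metric.isOpen_iff]
  rintro b ⟨hb, hp⟩
  obtain ⟨ε, hε, hball⟩ := Metric.isOpen_iff.1 hK.isClosed.isOpen_compl b hb
  refine ⟨ε, hε, fun b' hb' => ⟨hball hb', ?_⟩⟩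
  rwa [← propext (hasLogOn_sub_of_near fun z hz => ?_)]
  have : ε ≤ ‖z - b‖ := by
    by_contra h
    exact hball (by rw [Metric.mem_ball, dist_eq_norm]; linarith) hz
  rw [Metric.mem_ball, dist_eq_norm] at hb'
  linarith

/-- On a compact part of a set `G` without holes, `z ↦ z - a` has a continuous logarithm if
`a ∉ G`. -/
theorem NoHoles.hasLogOn_sub {G K : Set ℂ} (hG : NoHoles G) (hGo : IsOpen G) (hK : IsCompact K)
    (hKG : K ⊆ G) {a : ℂ} (ha : a ∉ G) : HasLogOn (fun z => z - a) K := by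
  by_contra hcon
  have hempty : {b | b ∉ G ∧ ¬ HasLogOn (fun z => z - b) K} = ∅ := by
    apply hG
    · refine Metric.isCompact_of_isClosed_isBounded ?_ ?_
      · have : {b | b ∉ G ∧ ¬ HasLogOn (fun z => z - b) K} =
            Gᶜ ∩ {b | b ∉ K ∧ HasLogOn (fun z => z - b) K}ᶜ := by
          ext b
          have := @hKG b
          simp only [mem_ofPred_eq, mem_inter_iff, mem_compl_iff]
          tauto
        rw [this]
        exact hGo.isClosed_compl.inter (isOpen_setOf_hasLogOn_iff hK id).isClosed_compl
      · obtain ⟨R, hR⟩ := hK.isBounded.subset_ball 0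
        refine (Metric.isBounded_closedBall (x := (0 : ℂ)) (r := R)).subset ?_
        rintro b ⟨-, hb⟩
        by_contra hbR
        rw [mem_closedBall_zero_iff, not_le] at hbR
        refine hb (hasLogOn_sub_of_far fun z hz => ?_)
        have := hR hz
        rw [mem_ball_zero_iff] at this
        linarith
    · rw [disjoint_left]
      exact fun b hb => hb.1
    · have : G ∪ {b | b ∉ G ∧ ¬ HasLogOn (fun z => z - b) K} =
          G ∪ {b | b ∉ K ∧ ¬ HasLogOn (fun z => z - b) K} := by
        ext b
        have := @hKG b
        simp only [mem_ofPred_eq, mem_union]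
        tauto
      rw [this]
      exact hGo.union (isOpen_setOf_hasLogOn_iff hK Not)
  have : a ∈ (∅ : Set ℂ) := by rw [← hempty]; exact ⟨ha, hcon⟩
  exact this

/-- A continuous nonvanishing function on the ball of radius `r` has a continuous logarithm. -/
theorem hasLogOn_ball {F : ℂ → ℂ} {a : ℂ} {r : ℝ} (hr : 0 < r)
    (hF : ContinuousOn F (Metric.ball a r)) (hne : ∀ z ∈ Metric.ball a r, F z ≠ 0) :
    HasLogOn F (Metric.ball a r) := by
  have hsc : IsSimplyConnected (Metric.ball a r) := by
    have : ContractibleSpace (Metric.ball a r) :=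
      (convex_ball a r).contractibleSpace ⟨a, Metric.mem_ball_self hr⟩
    exact SimplyConnectedSpace.ofContractible _
  obtain ⟨L, hL, h⟩ := Complex.exists_continuousOn_eqOn_exp_comp hsc Metric.isOpen_ball hF
    (by rintro ⟨z, hz, h0⟩; exact hne z hz h0)
  exact ⟨L, hL, h⟩

/-- If `z ↦ z - a` has a continuous logarithm on the compact parts of `G`, for all `a ∉ G`, then
`G` has no holes. -/
theorem noHoles_of_hasLogOn {G : Set ℂ}
    (h : ∀ a ∉ G, ∀ K ⊆ G, IsCompact K → HasLogOn (fun z => z - a) K) : NoHoles G := by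
  intro C hC hd ho
  by_contra hne
  obtain ⟨a, haC⟩ := nonempty_iff_ne_empty.2 hne
  have haG : a ∉ G := disjoint_left.1 hd haC
  obtain ⟨δ, hδ, hδO⟩ := hC.exists_cthickening_subset_open ho subset_union_right
  set d : ℂ → ℝ := fun z => Metric.infDist z C with hdef
  have hdc : Continuous d := Metric.continuous_infDist_pt C
  have hth : ∀ z, d z ≤ δ → z ∈ Metric.cthickening δ C := fun z hz => by
    rw [hC.cthickening_eq_biUnion_closedBall hδ.le]
    obtain ⟨y, hy, hzy⟩ := hC.exists_infDist_eq_dist ⟨a, haC⟩ z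
    exact mem_biUnion hy (by rw [Metric.mem_closedBall, ← hzy]; exact hz)
  have hcomp : IsCompact (Metric.cthickening δ C) := hC.cthickening
  set K : Set ℂ := Metric.cthickening δ C ∩ {z | δ / 2 ≤ d z ∧ d z ≤ δ} with hKdef
  have hKc : IsCompact K := hcomp.inter_right
    ((isClosed_le continuous_const hdc).inter (isClosed_le hdc continuous_const))
  have hKG : K ⊆ G := by
    rintro z ⟨hz, hz1, -⟩
    rcases hδO hz with h | h
    · exact h
    · have : d z = 0 := Metric.infDist_zero_of_mem h
      linarith
  obtain ⟨L, hL, hexp⟩ := h a haG K hKG hKc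
  -- Tietze extension of the logarithm from the shell `K` around the hole. It allows z - a to be
  -- replaced near the hole by a zero-free function `F` that agrees with it where `d z = δ`. A
  -- logarithm of `F` on a large ball then restricts to one of z - a on a circle around a.
  obtain ⟨L', hL'⟩ := ContinuousMap.exists_restrict_eq hKc.isClosed
    ⟨K.domRestrict L, continuousOn_iff_continuous_domRestrict.1 hL⟩
  have hL'K : ∀ z ∈ K, L' z = L z := fun z hz => by
    exact congrArg (fun g => g ⟨z, hz⟩) hL'
  set F : ℂ → ℂ := fun z =>
    if d z ≤ δ then Complex.exp ((max 0 (2 * d z / δ - 1) : ℝ) * L' z) else z - a with hFdef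
  have hFc : Continuous F := by
    refine Continuous.if_le ?_ (by fun_prop) hdc continuous_const ?_
    · have := L'.continuous
      fun_prop
    · intro z hz
      have hzK : z ∈ K := ⟨hth z hz.le, by rw [mem_ofPred_eq, hz]; constructor <;> linarith⟩
      rw [hz, hL'K z hzK, ← show Complex.exp (L z) = z - a from hexp z hzK]
      have : max 0 (2 * δ / δ - 1) = 1 := by
        rw [mul_div_cancel_right₀ _ hδ.ne']; norm_num
      rw [this]; simp
  have hFne : ∀ z, F z ≠ 0 := by
    intro z
    simp only [hFdef]
    split_ifs with hz
    · exact Complex.exp_ne_zero _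
    · intro h0
      apply hz
      have hza : z = a := sub_eq_zero.1 h0
      have : d z = 0 := Metric.infDist_zero_of_mem (hza ▸ haC)
      rw [this]; exact hδ.le
  obtain ⟨R, hR0, hR⟩ := hcomp.isBounded.subset_ball_lt 0 a
  obtain ⟨Λ, hΛ, hΛe⟩ := hasLogOn_ball (a := a) (r := R + 1) (by linarith) hFc.continuousOn
    (fun z _ => hFne z)
  have hmaps : MapsTo (fun z => z + a) (Metric.sphere (0 : ℂ) R) (Metric.ball a (R + 1)) := by
    intro z hz
    rw [mem_sphere_zero_iff_norm] at hz
    simp [hz]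
  refine not_hasLogOn_id_of_symmetric (K := Metric.sphere (0 : ℂ) R) ?_ ?_
    ⟨fun z => Λ (z + a), hΛ.comp (by fun_prop) hmaps, ?_⟩
  · exact isConnected_sphere (by simp) 0 hR0.le
  · intro z hz; simpa using hz
  · intro z hz
    rw [hΛe _ (hmaps hz)]
    have hnot : ¬ d (z + a) ≤ δ := by
      intro hle
      have := hR (hth _ hle)
      rw [mem_sphere_zero_iff_norm] at hz
      simp [hz] at this
    simp only [hFdef, if_neg hnot]
    simp

/-! ### The Green function of a quadratic polynomial -/

theorem continuous_quad (c : ℂ) : Continuous (quad c) := by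
  unfold quad; fun_prop

theorem differentiable_quad (c : ℂ) : Differentiable ℂ (quad c) := by
  unfold quad; fun_prop

theorem quad_neg (c z : ℂ) : quad c (-z) = quad c z := by
  simp [quad]

theorem quad_eq_quad_iff {c z w : ℂ} : quad c z = quad c w ↔ z = w ∨ z = -w := by
  simp [quad, sq_eq_sq_iff_eq_or_eq_neg]

theorem exists_quad_eq (c w : ℂ) : ∃ z, quad c z = w := by
  obtain ⟨z, hz⟩ := IsAlgClosed.exists_pow_nat_eq (w - c) two_pos
  exact ⟨z, by rw [quad, hz]; ring⟩

theorem quad_iterate_neg (c z : ℂ) {n : ℕ} (hn : n ≠ 0) :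
    (quad c)^[n] (-z) = (quad c)^[n] z := by
  obtain ⟨m, rfl⟩ := Nat.exists_eq_succ_of_ne_zero hn
  simp [Function.iterate_succ_apply, quad_neg]

/-- The shift for which `log (‖z‖ + shift)` is a subsolution of the functional equation of the
Green function. -/
noncomputable def greenShift (c : ℂ) : ℝ := 1 + ‖c‖

theorem one_le_greenShift (c : ℂ) : 1 ≤ greenShift c := by
  unfold greenShift; linarith [norm_nonneg c]

/-- The upper approximations of the Green function. -/
noncomputable def greenApprox (c : ℂ) (n : ℕ) (z : ℂ) : ℝ :=
  Real.log (‖(quad c)^[n] z‖ + greenShift c) / 2 ^ n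

theorem norm_quad_add_le (c z : ℂ) :
    ‖quad c z‖ + greenShift c ≤ (‖z‖ + greenShift c) ^ 2 := by
  have h1 : ‖quad c z‖ ≤ ‖z‖ ^ 2 + ‖c‖ := by
    rw [quad, ← norm_pow]; exact norm_add_le _ _
  unfold greenShift
  nlinarith [norm_nonneg c, norm_nonneg z, mul_nonneg (norm_nonneg c) (norm_nonneg z)]

/-- Follows from (r + s)² ≤ 2r² + 2s² with r = ‖z‖, s = `greenShift c`, and r² ≤ ‖`quad c z`‖ + s -
1. -/
theorem le_norm_quad_add (c z : ℂ) :
    (‖z‖ + greenShift c) ^ 2 ≤ (2 + 2 * greenShift c) * (‖quad c z‖ + greenShift c) := by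
  have h1 : ‖z‖ ^ 2 ≤ ‖quad c z‖ + ‖c‖ := by
    rw [← norm_pow]
    calc ‖z ^ 2‖ = ‖quad c z - c‖ := by simp [quad]
      _ ≤ _ := norm_sub_le _ _
  have h2 : ‖c‖ = greenShift c - 1 := by unfold greenShift; ring
  have h3 := one_le_greenShift c
  have h4 := norm_nonneg (quad c z)
  nlinarith [sq_nonneg (‖z‖ - greenShift c), mul_nonneg h4 (zero_le_one.trans h3)]

theorem norm_add_greenShift_pos (c z : ℂ) : 0 < ‖z‖ + greenShift c := by
  linarith [norm_nonneg z, one_le_greenShift c]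

theorem greenApprox_succ_le (c : ℂ) (n : ℕ) (z : ℂ) :
    greenApprox c (n + 1) z ≤ greenApprox c n z := by
  unfold greenApprox
  rw [Function.iterate_succ_apply', pow_succ, div_le_div_iff₀ (by positivity) (by positivity)]
  have h := Real.log_le_log (norm_add_greenShift_pos c _) (norm_quad_add_le c ((quad c)^[n] z))
  rw [Real.log_pow] at h
  have h2 : (0 : ℝ) < 2 ^ n := by positivity
  push_cast at h
  nlinarith

theorem greenApprox_le_succ (c : ℂ) (n : ℕ) (z : ℂ) :
    greenApprox c n z ≤
      greenApprox c (n + 1) z + Real.log (2 + 2 * greenShift c) / 2 ^ (n + 1) := by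
  unfold greenApprox
  rw [Function.iterate_succ_apply', ← add_div, pow_succ,
    div_le_div_iff₀ (by positivity) (by positivity)]
  have hA : 0 < 2 + 2 * greenShift c := by linarith [one_le_greenShift c]
  have h := Real.log_le_log (pow_pos (norm_add_greenShift_pos c _) 2)
    (le_norm_quad_add c ((quad c)^[n] z))
  rw [Real.log_pow, Real.log_mul hA.ne' (norm_add_greenShift_pos c _).ne'] at h
  have h2 : (0 : ℝ) < 2 ^ n := by positivity
  push_cast at h
  nlinarith

theorem greenApprox_antitone (c z : ℂ) : Antitone fun n => greenApprox c n z :=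
  antitone_nat_of_succ_le fun n => greenApprox_succ_le c n z

/-- The one-step errors log A / 2^(n+1) sum to log A / 2^n. With the antitone bound this traps the
Green function within a distance of `greenApprox` that is independent of the point, whence
continuity and two-sided growth estimates of orbits. -/
theorem greenApprox_sub_monotone (c z : ℂ) :
    Monotone fun n => greenApprox c n z - Real.log (2 + 2 * greenShift c) / 2 ^ n := by
  refine monotone_nat_of_le_succ fun n => ?_
  have h := greenApprox_le_succ c n z
  have : Real.log (2 + 2 * greenShift c) / 2 ^ n =
      2 * (Real.log (2 + 2 * greenShift c) / 2 ^ (n + 1)) := by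
    rw [pow_succ]; field_simp
  rw [this]
  linarith

theorem tendsto_div_two_pow (a : ℝ) : Tendsto (fun n : ℕ => a / 2 ^ n) atTop (𝓝 0) := by
  simp only [div_eq_mul_inv, ← inv_pow]
  simpa using (tendsto_pow_atTop_nhds_zero_of_lt_one (r := (2 : ℝ)⁻¹) (by norm_num)
    (by norm_num)).const_mul a

theorem tendsto_greenApprox (c z : ℂ) :
    Tendsto (fun n => greenApprox c n z) atTop (𝓝 (green c z)) := by
  obtain ⟨l, hl⟩ : ∃ l, Tendsto (fun n => greenApprox c n z) atTop (𝓝 l) := by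
    refine ⟨_, tendsto_atTop_ciInf (greenApprox_antitone c z) ⟨0, ?_⟩⟩
    rintro _ ⟨n, rfl⟩
    refine div_nonneg (Real.log_nonneg ?_) (by positivity)
    linarith [norm_nonneg ((quad c)^[n] z), one_le_greenShift c]
  have h1 : Tendsto (fun n : ℕ => Real.posLog ‖(quad c)^[n] z‖ / 2 ^ n) atTop (𝓝 l) := by
    have hlow : Tendsto (fun n => greenApprox c n z - Real.log (1 + greenShift c) / 2 ^ n) atTop
        (𝓝 l) := by
      simpa using hl.sub (tendsto_div_two_pow (Real.log (1 + greenShift c)))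
    refine tendsto_of_tendsto_of_tendsto_of_le_of_le hlow hl (fun n => ?_) (fun n => ?_)
    -- With r the norm of the iterate and s the shift, max(1, r) lies between (r + s)/(1 + s) and r
    -- + s; the factor 1 + s disappears after division by 2^n.
    · simp only [greenApprox]
      rw [← sub_div]
      gcongr
      rw [Real.posLog_eq_log_max_one (norm_nonneg _), ← Real.log_div
        (norm_add_greenShift_pos c _).ne' (by linarith [one_le_greenShift c])]
      have := one_le_greenShift c
      refine Real.log_le_log (div_pos (norm_add_greenShift_pos c _) (by linarith)) ?_
      rw [div_le_iff₀ (by linarith)]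
      have h1 := le_max_left 1 ‖(quad c)^[n] z‖
      have h2 := le_max_right 1 ‖(quad c)^[n] z‖
      nlinarith
    · simp only [greenApprox]
      gcongr
      rw [Real.posLog_eq_log_max_one (norm_nonneg _)]
      refine Real.log_le_log (lt_of_lt_of_le one_pos (le_max_left _ _)) (max_le ?_ ?_)
      · linarith [norm_nonneg ((quad c)^[n] z), one_le_greenShift c]
      · linarith [one_le_greenShift c]
  rw [green, h1.limUnder_eq]
  exact hl

theorem green_le_greenApprox (c z : ℂ) (n : ℕ) : green c z ≤ greenApprox c n z :=
  (greenApprox_antitone c z).le_of_tendsto (tendsto_greenApprox c z) n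

theorem greenApprox_le_green_add (c z : ℂ) (n : ℕ) :
    greenApprox c n z ≤ green c z + Real.log (2 + 2 * greenShift c) / 2 ^ n := by
  have := (greenApprox_sub_monotone c z).ge_of_tendsto
    ((tendsto_greenApprox c z).sub (tendsto_div_two_pow _)) n
  simp only [sub_zero] at this
  linarith

theorem exp_green_le (c z : ℂ) (n : ℕ) :
    Real.exp (2 ^ n * green c z) ≤ ‖(quad c)^[n] z‖ + greenShift c := by
  rw [← Real.le_log_iff_exp_le (norm_add_greenShift_pos c _)]
  have := green_le_greenApprox c z n
  rw [greenApprox, le_div_iff₀ (by positivity)] at this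
  linarith

theorem norm_iterate_le (c z : ℂ) (n : ℕ) :
    ‖(quad c)^[n] z‖ + greenShift c ≤ (2 + 2 * greenShift c) * Real.exp (2 ^ n * green c z) := by
  have := greenApprox_le_green_add c z n
  have hA : 0 < 2 + 2 * greenShift c := by linarith [one_le_greenShift c]
  have h2 : (0 : ℝ) < 2 ^ n := by positivity
  rw [greenApprox, div_le_iff₀ h2, add_mul, div_mul_cancel₀ _ h2.ne'] at this
  rw [← Real.log_le_log_iff (norm_add_greenShift_pos c _) (by positivity),
    Real.log_mul hA.ne' (Real.exp_ne_zero _), Real.log_exp]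
  linarith

theorem green_nonneg (c z : ℂ) : 0 ≤ green c z := by
  refine ge_of_tendsto' (tendsto_greenApprox c z) fun n => ?_
  refine div_nonneg (Real.log_nonneg ?_) (by positivity)
  linarith [norm_nonneg ((quad c)^[n] z), one_le_greenShift c]

theorem green_quad (c z : ℂ) : green c (quad c z) = 2 * green c z := by
  have h1 := (tendsto_greenApprox c z).comp (tendsto_add_atTop_nat 1) |>.const_mul 2
  refine tendsto_nhds_unique (tendsto_greenApprox c (quad c z)) (h1.congr fun n => ?_)
  simp only [Function.comp, greenApprox, Function.iterate_succ_apply, pow_succ]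
  field_simp

theorem green_neg (c z : ℂ) : green c (-z) = green c z := by
  have := green_quad c (-z)
  rw [quad_neg, green_quad] at this
  linarith

theorem green_quad_iterate (c z : ℂ) (n : ℕ) : green c ((quad c)^[n] z) = 2 ^ n * green c z := by
  induction n with
  | zero => simp
  | succ n ih => rw [Function.iterate_succ_apply', green_quad, ih, pow_succ]; ring

theorem continuous_quad_iterate (c : ℂ) (n : ℕ) : Continuous (quad c)^[n] :=
  (continuous_quad c).iterate n

theorem continuous_green (c : ℂ) : Continuous (green c) := by
  have hu : TendstoUniformly (fun n z => greenApprox c n z) (green c) atTop := by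
    rw [Metric.tendstoUniformly_iff]
    intro ε hε
    filter_upwards [(tendsto_div_two_pow (Real.log (2 + 2 * greenShift c))).eventually_lt_const hε]
      with n hn z
    rw [Real.dist_eq, abs_sub_comm, abs_of_nonneg (by linarith [green_le_greenApprox c z n])]
    linarith [greenApprox_le_green_add c z n]
  refine hu.continuous (Eventually.frequently (Eventually.of_forall fun n => ?_))
  refine Continuous.div_const ?_ _
  refine Continuous.log ?_ fun z => (norm_add_greenShift_pos c _).ne'
  exact (continuous_quad_iterate c n).norm.add continuous_const

/-- By `exp_green_le` a positive potential forces escape; by `norm_iterate_le` zero potential keeps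
the orbit bounded. -/
theorem mem_quadFilledJulia_iff {c z : ℂ} : z ∈ quadFilledJulia c ↔ green c z = 0 := by
  rw [quadFilledJulia, mem_ofPred_eq]
  constructor
  · intro h
    by_contra h0
    have hpos := lt_of_le_of_ne (green_nonneg c z) (Ne.symm h0)
    apply h
    rw [← Metric.cobounded_eq_cocompact, ← tendsto_norm_atTop_iff_cobounded]
    have h1 : Tendsto (fun n : ℕ => Real.exp (2 ^ n * green c z) - greenShift c) atTop atTop := by
      refine tendsto_atTop_add_const_right _ _ (Real.tendsto_exp_atTop.comp ?_)
      exact (tendsto_pow_atTop_atTop_of_one_lt one_lt_two).atTop_mul_const hpos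
    refine tendsto_atTop_mono (fun n => ?_) h1
    linarith [exp_green_le c z n]
  · intro h0 h
    rw [← Metric.cobounded_eq_cocompact, ← tendsto_norm_atTop_iff_cobounded] at h
    obtain ⟨n, hn⟩ := (h.eventually_gt_atTop (2 + 2 * greenShift c)).exists
    have := norm_iterate_le c z n
    rw [h0, mul_zero, Real.exp_zero] at this
    linarith [one_le_greenShift c]

theorem isCompact_green_le (c : ℂ) (h : ℝ) : IsCompact {z | green c z ≤ h} := by
  refine Metric.isCompact_of_isClosed_isBounded
    (isClosed_le (continuous_green c) continuous_const) ?_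
  refine (Metric.isBounded_closedBall (x := (0 : ℂ))
    (r := (2 + 2 * greenShift c) * Real.exp h)).subset fun z hz => ?_
  rw [mem_closedBall_zero_iff]
  have h1 := norm_iterate_le c z 0
  have h2 : Real.exp (green c z) ≤ Real.exp h := Real.exp_le_exp.2 hz
  simp only [Function.iterate_zero, id, pow_zero, one_mul] at h1
  have := one_le_greenShift c
  nlinarith

theorem isOpen_green_lt (c : ℂ) (h : ℝ) : IsOpen {z | green c z < h} :=
  isOpen_lt (continuous_green c) continuous_const

/-- A compact subset of the region `green < h` lies in the preimage of a round disk under some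
high iterate; the disk may be taken arbitrarily large. -/
theorem exists_subset_preimage_ball {c : ℂ} {h : ℝ} (hh : 0 < h) {K : Set ℂ} (hK : IsCompact K)
    (hKh : K ⊆ {z | green c z < h}) (R₀ : ℝ) :
    ∃ n : ℕ, ∃ R > R₀, K ⊆ (quad c)^[n] ⁻¹' Metric.ball 0 R ∧
      (quad c)^[n] ⁻¹' Metric.ball 0 R ⊆ {z | green c z < h} := by
  -- The sublevel set of the n-th upper approximation is exactly the preimage of the disk of radius
  -- exp(2^n h) - `greenShift c`. These sets increase to the region `green < h`, and compactness
  -- selects one of them.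
  set Q : ℕ → Set ℂ := fun n => {z | greenApprox c n z < h} with hQ
  have hQeq : ∀ n, Q n = (quad c)^[n] ⁻¹' Metric.ball 0 (Real.exp (2 ^ n * h) - greenShift c) := by
    intro n
    ext z
    simp only [hQ, mem_ofPred_eq, mem_preimage, mem_ball_zero_iff, greenApprox]
    rw [div_lt_iff₀ (by positivity), Real.log_lt_iff_lt_exp (norm_add_greenShift_pos c _),
      mul_comm, lt_sub_iff_add_lt]
  have hQo : ∀ n, IsOpen (Q n) := fun n => by
    rw [hQeq]; exact Metric.isOpen_ball.preimage (continuous_quad_iterate c n)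
  have hmono : Monotone Q := fun m n hmn z hz => lt_of_le_of_lt (greenApprox_antitone c z hmn) hz
  obtain ⟨n, hn⟩ := hK.elim_directed_cover Q hQo (fun z hz => by
    have := (tendsto_greenApprox c z).eventually_lt_const (hKh hz)
    exact mem_iUnion.2 this.exists) hmono.directed_le
  have h1 : Tendsto (fun n : ℕ => Real.exp (2 ^ n * h) - greenShift c) atTop atTop := by
    refine tendsto_atTop_add_const_right _ _ (Real.tendsto_exp_atTop.comp ?_)
    exact (tendsto_pow_atTop_atTop_of_one_lt one_lt_two).atTop_mul_const hh
  obtain ⟨m, hm, hnm⟩ := ((h1.eventually_gt_atTop R₀).and (eventually_ge_atTop n)).exists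
  refine ⟨m, _, hm, ?_, ?_⟩
  · rw [← hQeq]; exact hn.trans (hmono hnm)
  · rw [← hQeq]
    exact fun z hz => lt_of_le_of_lt (green_le_greenApprox c z m) hz

/-! ### Open mapping -/

theorem nhds_le_map_of_not_eventually_const {f : ℂ → ℂ} {U : Set ℂ} (hU : IsOpen U)
    (hf : DifferentiableOn ℂ f U) {z : ℂ} (hz : z ∈ U)
    (hfin : ¬ ∀ᶠ x in 𝓝 z, f x = f z) : 𝓝 (f z) ≤ map f (𝓝 z) :=
  (hf.analyticAt (hU.mem_nhds hz)).eventually_constant_or_nhds_le_map_nhds.resolve_left hfin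

/-- A holomorphic map with finite fibers is open. -/
theorem isOpen_image_of_finite_fibers {f : ℂ → ℂ} {U : Set ℂ} (hU : IsOpen U)
    (hf : DifferentiableOn ℂ f U) (hfin : ∀ w, (U ∩ f ⁻¹' {w}).Finite) :
    ∀ O ⊆ U, IsOpen O → IsOpen (f '' O) := by
  intro O hOU hO
  rw [isOpen_iff_mem_nhds]
  rintro _ ⟨z, hz, rfl⟩
  refine nhds_le_map_of_not_eventually_const hU hf (hOU hz) ?_ (image_mem_map (hO.mem_nhds hz))
  intro hev
  have hinf : (U ∩ f ⁻¹' {f z}) ∈ 𝓝 z := inter_mem (hU.mem_nhds (hOU hz)) hev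
  exact (infinite_of_mem_nhds z hinf) (hfin _)

theorem isOpen_quad_image (c : ℂ) : ∀ O ⊆ univ, IsOpen O → IsOpen (quad c '' O) := by
  refine isOpen_image_of_finite_fibers isOpen_univ (differentiable_quad c).differentiableOn ?_
  intro w
  obtain ⟨z, rfl⟩ := exists_quad_eq c w
  refine (Set.toFinite {z, -z}).subset ?_
  rintro x ⟨-, hx⟩
  exact quad_eq_quad_iff.1 hx

theorem NoHoles.preimage_quad {c : ℂ} {G : Set ℂ} (hG : NoHoles G) (ho : IsOpen G) :
    NoHoles (quad c ⁻¹' G) := by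
  simpa using noHoles_univ.pullback isOpen_univ hG ho (continuous_quad c).continuousOn
    (isOpen_quad_image c)

theorem NoHoles.preimage_quad_iterate {c : ℂ} {G : Set ℂ} (hG : NoHoles G) (ho : IsOpen G)
    (n : ℕ) : NoHoles ((quad c)^[n] ⁻¹' G) := by
  induction n with
  | zero => simpa using hG
  | succ n ih =>
    rw [Function.iterate_succ, preimage_comp]
    exact ih.preimage_quad (ho.preimage (continuous_quad_iterate c n))

/-- If the filled Julia set is connected, it contains the critical point. -/
theorem zero_mem_quadFilledJulia {c : ℂ} (hK : IsConnected (quadFilledJulia c)) :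
    (0 : ℂ) ∈ quadFilledJulia c := by
  by_contra h0
  have hg0 : 0 < green c 0 :=
    lt_of_le_of_ne (green_nonneg c 0) (fun h => h0 (mem_quadFilledJulia_iff.2 h.symm))
  have hKeq : quadFilledJulia c = {z | green c z ≤ 0} := by
    ext z
    rw [mem_quadFilledJulia_iff]
    exact ⟨fun h => h.le, fun h => le_antisymm h (green_nonneg c z)⟩
  have hKc : IsCompact (quadFilledJulia c) := hKeq ▸ isCompact_green_le c 0
  -- If 0 escaped, the filled Julia set, symmetric and connected, would lie in a hole-free set
  -- omitting 0, and log z would exist on it.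
  obtain ⟨n, R, -, hKR, hRh⟩ := exists_subset_preimage_ball hg0 hKc
    (fun z hz => by rw [mem_ofPred_eq, mem_quadFilledJulia_iff.1 hz]; exact hg0) 0
  have hlog := ((noHoles_ball R).preimage_quad_iterate Metric.isOpen_ball n).hasLogOn_sub
    (Metric.isOpen_ball.preimage (continuous_quad_iterate c n)) hKc hKR (a := 0)
    (fun h => lt_irrefl (green c 0) (hRh h))
  refine not_hasLogOn_id_of_symmetric hK (fun z hz => ?_) (by simp only [sub_zero] at hlog; exact hlog)
  rw [mem_quadFilledJulia_iff, green_neg]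
  exact mem_quadFilledJulia_iff.1 hz

/-! ### Conformal disks -/

/-- An injective holomorphic map is nowhere locally constant, hence open. -/
theorem continuousOn_invFunOn {σ : ℂ → ℂ} {U D : Set ℂ} (hU : IsOpen U)
    (hσ : DifferentiableOn ℂ σ U) (hbij : BijOn σ U D) :
    ContinuousOn (Function.invFunOn σ U) D := by
  intro y hy
  obtain ⟨u, hu, rfl⟩ := hbij.surjOn hy
  refine ContinuousAt.continuousWithinAt ?_
  rw [ContinuousAt, hbij.injOn.leftInvOn_invFunOn hu]
  have hne : ¬ ∀ᶠ x in 𝓝 u, σ x = σ u := by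
    intro hev
    have : ∀ᶠ x in 𝓝[≠] u, x = u := by
      filter_upwards [(hev.and (hU.mem_nhds hu)).filter_mono nhdsWithin_le_nhds] with x hx
      exact hbij.injOn hx.2 hu hx.1
    obtain ⟨x, hx, hx'⟩ := (this.and self_mem_nhdsWithin).exists
    exact hx' hx
  intro N hN
  have h1 := nhds_le_map_of_not_eventually_const hU hσ hu hne
    (image_mem_map (inter_mem hN (hU.mem_nhds hu)))
  refine mem_map.2 (mem_of_superset h1 ?_)
  rintro _ ⟨x, ⟨hxN, hxU⟩, rfl⟩
  rw [mem_preimage, hbij.injOn.leftInvOn_invFunOn hxU]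
  exact hxN

/-- `σ` is a conformal isomorphism of the unit disk onto `D`, with center `p`. -/
structure IsRiemannMap (σ : ℂ → ℂ) (D : Set ℂ) (p : ℂ) : Prop where
  holo : DifferentiableOn ℂ σ (Metric.ball 0 1)
  bij : BijOn σ (Metric.ball 0 1) D
  deriv_ne_zero : ∀ u ∈ Metric.ball (0 : ℂ) 1, deriv σ u ≠ 0
  center : σ 0 = p

theorem IsRiemannMap.hasLogOn {σ : ℂ → ℂ} {D : Set ℂ} {p : ℂ} (hσ : IsRiemannMap σ D p)
    {F : ℂ → ℂ} (hF : ContinuousOn F D) (hne : ∀ z ∈ D, F z ≠ 0) : HasLogOn F D := by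
  obtain ⟨L, hL, hexp⟩ := hasLogOn_ball (F := F ∘ σ) one_pos
    (hF.comp hσ.holo.continuousOn hσ.bij.mapsTo) (fun u hu => hne _ (hσ.bij.mapsTo hu))
  refine ⟨L ∘ Function.invFunOn σ (Metric.ball 0 1),
    hL.comp (continuousOn_invFunOn Metric.isOpen_ball hσ.holo hσ.bij)
      hσ.bij.surjOn.mapsTo_invFunOn, fun z hz => ?_⟩
  rw [Function.comp, hexp _ (hσ.bij.surjOn.mapsTo_invFunOn hz), Function.comp,
    hσ.bij.surjOn.rightInvOn_invFunOn hz]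

/-- A Möbius automorphism of the unit disk. -/
noncomputable def moebius (a u : ℂ) : ℂ := (u + a) / (1 + starRingEnd ℂ a * u)

theorem moebius_denom_ne_zero {a u : ℂ} (ha : ‖a‖ < 1) (hu : ‖u‖ < 1) :
    1 + starRingEnd ℂ a * u ≠ 0 := by
  intro h
  have h1 : starRingEnd ℂ a * u = -1 := by linear_combination h
  have h2 : ‖a‖ * ‖u‖ = 1 := by
    rw [← RCLike.norm_conj a, ← norm_mul, h1, norm_neg, norm_one]
  nlinarith [norm_nonneg a, norm_nonneg u]

theorem norm_moebius_lt_one {a u : ℂ} (ha : ‖a‖ < 1) (hu : ‖u‖ < 1) : ‖moebius a u‖ < 1 := by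
  have hd := moebius_denom_ne_zero ha hu
  rw [moebius, norm_div, div_lt_one (norm_pos_iff.2 hd)]
  refine lt_of_pow_lt_pow_left₀ 2 (norm_nonneg _) ?_
  have ha2 : ‖a‖ ^ 2 < 1 := by nlinarith [norm_nonneg a]
  have hu2 : ‖u‖ ^ 2 < 1 := by nlinarith [norm_nonneg u]
  simp only [← Complex.normSq_eq_norm_sq, Complex.normSq_apply, Complex.add_re, Complex.add_im,
    Complex.mul_re, Complex.mul_im, Complex.conj_re, Complex.conj_im, Complex.one_re,
    Complex.one_im] at *
  nlinarith [mul_pos (sub_pos.2 ha2) (sub_pos.2 hu2)]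

theorem moebius_neg_moebius {a u : ℂ} (ha : ‖a‖ < 1) (hu : ‖u‖ < 1) :
    moebius (-a) (moebius a u) = u := by
  have hd := moebius_denom_ne_zero ha hu
  have hd' := moebius_denom_ne_zero (a := -a) (by rwa [norm_neg]) (norm_moebius_lt_one ha hu)
  have hm : moebius a u * (1 + starRingEnd ℂ a * u) = u + a := div_mul_cancel₀ _ hd
  rw [map_neg] at hd'
  rw [moebius, map_neg, div_eq_iff hd']
  refine mul_right_cancel₀ hd ?_
  linear_combination (1 + u * starRingEnd ℂ a) * hm

theorem differentiableAt_moebius {a u : ℂ} (ha : ‖a‖ < 1) (hu : ‖u‖ < 1) :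
    DifferentiableAt ℂ (moebius a) u := by
  unfold moebius
  exact DifferentiableAt.div (by fun_prop) (by fun_prop) (moebius_denom_ne_zero ha hu)

theorem deriv_moebius_ne_zero {a u : ℂ} (ha : ‖a‖ < 1) (hu : ‖u‖ < 1) :
    deriv (moebius a) u ≠ 0 := by
  intro h0
  have hev : moebius (-a) ∘ moebius a =ᶠ[𝓝 u] id := by
    filter_upwards [Metric.isOpen_ball.mem_nhds (mem_ball_zero_iff.2 hu)] with x hx
    exact moebius_neg_moebius ha (mem_ball_zero_iff.1 hx)
  have h1 := hev.deriv_eq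
  rw [deriv_comp u (differentiableAt_moebius (by rwa [norm_neg]) (norm_moebius_lt_one ha hu))
    (differentiableAt_moebius ha hu), h0, mul_zero] at h1
  simp at h1

theorem bijOn_moebius {a : ℂ} (ha : ‖a‖ < 1) :
    BijOn (moebius a) (Metric.ball 0 1) (Metric.ball 0 1) := by
  have ha' : ‖-a‖ < 1 := by rwa [norm_neg]
  refine BijOn.mk (fun u hu => ?_) (fun u hu v hv huv => ?_) (fun u hu => ?_)
  · rw [mem_ball_zero_iff] at *
    exact norm_moebius_lt_one ha hu
  · rw [mem_ball_zero_iff] at *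
    rw [← moebius_neg_moebius ha hu, huv, moebius_neg_moebius ha hv]
  · rw [mem_ball_zero_iff] at hu
    refine ⟨moebius (-a) u, mem_ball_zero_iff.2 (norm_moebius_lt_one ha' hu), ?_⟩
    simpa using moebius_neg_moebius ha' hu

theorem IsRiemannMap.recenter {σ : ℂ → ℂ} {D : Set ℂ} {p p' : ℂ} (hσ : IsRiemannMap σ D p)
    (hp' : p' ∈ D) : ∃ τ, IsRiemannMap τ D p' := by
  obtain ⟨a, ha, rfl⟩ := hσ.bij.surjOn hp'
  rw [mem_ball_zero_iff] at ha
  refine ⟨σ ∘ moebius a, ?_, hσ.bij.comp (bijOn_moebius ha), fun u hu => ?_, ?_⟩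
  · refine hσ.holo.comp (fun u hu => ?_) (bijOn_moebius ha).mapsTo
    exact (differentiableAt_moebius ha (mem_ball_zero_iff.1 hu)).differentiableWithinAt
  · have hu' := mem_ball_zero_iff.1 hu
    have hm := (bijOn_moebius ha).mapsTo hu
    rw [deriv_comp u (hσ.holo.differentiableAt (Metric.isOpen_ball.mem_nhds hm))
      (differentiableAt_moebius ha hu')]
    exact mul_ne_zero (hσ.deriv_ne_zero _ hm) (deriv_moebius_ne_zero ha hu')
  · simp [moebius]

/-- A continuous square root of a nonvanishing holomorphic function is holomorphic. -/
theorem differentiableAt_of_sq_eq {r k : ℂ → ℂ} {z : ℂ} (hr : ContinuousAt r z)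
    (hk : DifferentiableAt ℂ k z) (hrk : ∀ᶠ x in 𝓝 z, r x ^ 2 = k x) (hne : r z ≠ 0) :
    DifferentiableAt ℂ r z := by
  have hsum : Tendsto (fun x => r x + r z) (𝓝 z) (𝓝 (r z + r z)) := hr.add tendsto_const_nhds
  have h2 : r z + r z ≠ 0 := by
    rw [← two_mul]; exact mul_ne_zero two_ne_zero hne
  have hslope := (hasDerivAt_iff_tendsto_slope.1 hk.hasDerivAt).div
    (hsum.mono_left nhdsWithin_le_nhds) h2
  refine (hasDerivAt_iff_tendsto_slope.2 (hslope.congr' ?_)).differentiableAt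
  filter_upwards [(hsum.eventually_ne h2).filter_mono nhdsWithin_le_nhds,
    hrk.filter_mono nhdsWithin_le_nhds, self_mem_nhdsWithin] with x hx hx2 hxz
  have hxz' : x - z ≠ 0 := sub_ne_zero.2 hxz
  simp only [Pi.div_apply, slope_def_field]
  rw [← hx2, ← hrk.self_of_nhds]
  field_simp
  ring

/-- The preimage under `quad c` of a conformal disk that contains the critical value is a
conformal disk. -/
theorem IsRiemannMap.preimage_quad {σ : ℂ → ℂ} {D : Set ℂ} {c : ℂ} (hσ : IsRiemannMap σ D c) :
    ∃ τ, IsRiemannMap τ (quad c ⁻¹' D) 0 := by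
  set B := Metric.ball (0 : ℂ) 1 with hB
  have hBo : IsOpen B := Metric.isOpen_ball
  have h0B : (0 : ℂ) ∈ B := by simp [hB]
  have hsq : MapsTo (fun u : ℂ => u ^ 2) B B := by
    intro u hu
    rw [hB, mem_ball_zero_iff] at *
    rw [norm_pow]
    nlinarith [norm_nonneg u]
  have hnegB : MapsTo (fun u : ℂ => -u) B B := by
    intro u hu
    rw [hB, mem_ball_zero_iff] at *
    rwa [norm_neg]
  -- σ(u²) - c = u² k(u), where k has no zeros since σ is injective with nonzero derivative at 0. So
  -- u times a square root of k lifts σ(u²) through `quad c`.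
  set k : ℂ → ℂ := fun u => dslope σ 0 (u ^ 2) with hk
  have hkd : DifferentiableOn ℂ k B :=
    ((Complex.differentiableOn_dslope (hBo.mem_nhds h0B)).2 hσ.holo).comp
      (by fun_prop) hsq
  have hku : ∀ u, u ^ 2 * k u = σ (u ^ 2) - c := by
    intro u
    have := sub_smul_dslope σ 0 (u ^ 2)
    rw [sub_zero, smul_eq_mul, hσ.center] at this
    exact this
  have hkne : ∀ u ∈ B, k u ≠ 0 := by
    intro u hu h0
    by_cases hu0 : u = 0
    · subst hu0
      simp only [hk, ne_eq, OfNat.ofNat_ne_zero, not_false_eq_true, zero_pow, dslope_same] at h0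
      exact hσ.deriv_ne_zero 0 h0B h0
    · have h1 := hku u
      rw [h0, mul_zero, eq_comm, sub_eq_zero, ← hσ.center] at h1
      exact hu0 (by simpa using hσ.bij.injOn (hsq hu) h0B h1)
  obtain ⟨L, hL, hexp⟩ := hasLogOn_ball one_pos hkd.continuousOn hkne
  set r : ℂ → ℂ := fun u => Complex.exp (L u / 2) with hr
  have hrk : ∀ u ∈ B, r u ^ 2 = k u := by
    intro u hu
    rw [← hexp u hu, hr, ← Complex.exp_nat_mul]
    congr 1
    push_cast; ring
  have hrne : ∀ u, r u ≠ 0 := fun u => Complex.exp_ne_zero _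
  have hrc : ContinuousOn r B := Complex.continuous_exp.comp_continuousOn (hL.div_const 2)
  have hrd : DifferentiableOn ℂ r B := fun u hu =>
    (differentiableAt_of_sq_eq (hrc.continuousAt (hBo.mem_nhds hu))
      (hkd.differentiableAt (hBo.mem_nhds hu))
      (by filter_upwards [hBo.mem_nhds hu] with x hx using hrk x hx) (hrne u)).differentiableWithinAt
  -- The functions r(-u) and r(u) have equal squares and agree at 0, hence everywhere. Thus τ is
  -- odd, which separates u from -u and gives both injectivity and surjectivity.
  have hreven : EqOn (fun u => r (-u)) r B := by
    refine (convex_ball (0 : ℂ) 1).isPreconnected.eq_of_sq_eq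
      (hrc.comp continuousOn_neg hnegB) hrc (fun u hu => ?_) (fun {u} _ => hrne u) h0B (by simp)
    simp only [Pi.pow_apply]
    rw [hrk _ (hnegB hu), hrk u hu]
    simp [hk]
  set τ : ℂ → ℂ := fun u => u * r u with hτ
  have hτd : DifferentiableOn ℂ τ B := differentiableOn_id.mul hrd
  have hτq : ∀ u ∈ B, quad c (τ u) = σ (u ^ 2) := by
    intro u hu
    rw [quad, hτ, mul_pow, hrk u hu, hku]; ring
  have hτneg : ∀ u ∈ B, τ (-u) = -τ u := by
    intro u hu
    have := hreven hu
    simp only [hτ] at this ⊢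
    rw [this]; ring
  have hτ0 : ∀ u, τ u = 0 → u = 0 := fun u hu => (mul_eq_zero.1 hu).resolve_right (hrne u)
  refine ⟨τ, hτd, BijOn.mk (fun u hu => ?_) (fun u hu v hv huv => ?_) (fun z hz => ?_),
    fun u hu => ?_, by simp [hτ]⟩
  · rw [mem_preimage, hτq u hu]
    exact hσ.bij.mapsTo (hsq hu)
  · have h1 : σ (u ^ 2) = σ (v ^ 2) := by rw [← hτq u hu, huv, hτq v hv]
    rcases sq_eq_sq_iff_eq_or_eq_neg.1 (hσ.bij.injOn (hsq hu) (hsq hv) h1) with h | h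
    · exact h
    · rw [h, hτneg v hv] at huv
      have hv0 : v = 0 := hτ0 v (by linear_combination -huv / 2)
      rw [h, hv0, neg_zero]
  · obtain ⟨w, hw, hwz⟩ := hσ.bij.surjOn hz
    obtain ⟨u, rfl⟩ := IsAlgClosed.exists_pow_nat_eq w two_pos
    have hu : u ∈ B := by
      rw [hB, mem_ball_zero_iff] at *
      rw [norm_pow] at hw
      by_contra h
      nlinarith
    rw [← hτq u hu, quad_eq_quad_iff] at hwz
    rcases hwz with h | h
    · exact ⟨u, hu, h⟩
    · exact ⟨-u, hnegB hu, by rw [hτneg u hu, h, neg_neg]⟩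
  · have hud := hτd.differentiableAt (hBo.mem_nhds hu)
    intro hd0
    by_cases hu0 : u = 0
    · subst hu0
      have := ((hasDerivAt_id (0 : ℂ)).mul (hrd.differentiableAt (hBo.mem_nhds hu)).hasDerivAt).deriv
      rw [show (id * r : ℂ → ℂ) = τ from rfl, hd0] at this
      exact hrne 0 (by simpa using this.symm)
    · have hev : quad c ∘ τ =ᶠ[𝓝 u] σ ∘ fun u => u ^ 2 := by
        filter_upwards [hBo.mem_nhds hu] with x hx using hτq x hx
      have h1 := hev.deriv_eq
      rw [deriv_comp u (differentiable_quad c _) hud, hd0, mul_zero, deriv_comp u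
        (hσ.holo.differentiableAt (hBo.mem_nhds (hsq hu))) (by fun_prop), eq_comm,
        mul_eq_zero] at h1
      rcases h1 with h1 | h1
      · exact hσ.deriv_ne_zero _ (hsq hu) h1
      · simp [hu0] at h1

theorem isRiemannMap_ball {R : ℝ} (hR : 0 < R) :
    IsRiemannMap (fun u => R * u) (Metric.ball 0 R) 0 := by
  have hR' : (R : ℂ) ≠ 0 := by exact_mod_cast hR.ne'
  refine ⟨by fun_prop, BijOn.mk (fun u hu => ?_) (fun u _ v _ huv => ?_) (fun z hz => ?_),
    fun u _ => ?_, by simp⟩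
  · rw [mem_ball_zero_iff] at *
    rw [norm_mul, Complex.norm_real, Real.norm_of_nonneg hR.le]
    nlinarith
  · exact mul_left_cancel₀ hR' huv
  · refine ⟨z / R, ?_, by field_simp⟩
    rw [mem_ball_zero_iff] at *
    rwa [norm_div, Complex.norm_real, Real.norm_of_nonneg hR.le, div_lt_one hR]
  · rw [deriv_const_mul _ differentiableAt_fun_id]
    simpa using hR'

/-- As the critical orbit stays in the ball, every preimage contains the critical value; recentering
there lets the square root construction be repeated. -/
theorem exists_isRiemannMap_preimage_iterate {c : ℂ} {R : ℝ}
    (hc : ∀ n, (quad c)^[n] c ∈ Metric.ball 0 R) (n : ℕ) :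
    ∃ σ, IsRiemannMap σ ((quad c)^[n] ⁻¹' Metric.ball 0 R) 0 := by
  have hR : 0 < R := (norm_nonneg _).trans_lt (mem_ball_zero_iff.1 (hc 0))
  induction n with
  | zero => exact ⟨_, isRiemannMap_ball hR⟩
  | succ n ih =>
    obtain ⟨σ, hσ⟩ := ih
    obtain ⟨τ, hτ⟩ := hσ.recenter (p' := c) (hc n)
    rw [Function.iterate_succ, preimage_comp]
    exact hτ.preimage_quad

/-- If the critical point does not escape, then continuous nonvanishing functions have continuous
logarithms on compact parts of the disk bounded by an equipotential. -/
theorem hasLogOn_of_subset_green_lt {c : ℂ} (h0 : (0 : ℂ) ∈ quadFilledJulia c) {h : ℝ}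
    (hh : 0 < h) {K : Set ℂ} (hK : IsCompact K) (hKh : K ⊆ {z | green c z < h}) {F : ℂ → ℂ}
    (hF : ContinuousOn F {z | green c z < h}) (hne : ∀ z, green c z < h → F z ≠ 0) :
    HasLogOn F K := by
  -- The radius R₀ bounds the filled Julia set, hence the whole orbit of the critical value; the
  -- large disk is chosen to contain it.
  obtain ⟨R₀, hR₀⟩ := (isCompact_green_le c 0).isBounded.subset_ball 0
  obtain ⟨n, R, hR, hKR, hRh⟩ := exists_subset_preimage_ball hh hK hKh R₀
  have hc : ∀ n, (quad c)^[n] c ∈ Metric.ball 0 R := by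
    intro n
    refine Metric.ball_subset_ball hR.le (hR₀ ?_)
    have : green c c = 0 := by
      have := green_quad c 0
      rwa [mem_quadFilledJulia_iff.1 h0, mul_zero, quad, zero_pow two_ne_zero, zero_add] at this
    rw [mem_ofPred_eq, green_quad_iterate, this, mul_zero]
  obtain ⟨σ, hσ⟩ := exists_isRiemannMap_preimage_iterate hc n
  exact (hσ.hasLogOn (hF.mono hRh) fun z hz => hne z (hRh hz)).mono hKR

/-- The image of the disk bounded by an equipotential under a homeomorphism has no holes. -/
theorem noHoles_green_comp_lt {c : ℂ} (h0 : (0 : ℂ) ∈ quadFilledJulia c) {h : ℝ}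
    (hh : 0 < h) (φ : OpenPartialHomeomorph ℂ ℂ) (hφ : {w | green c w < h} ⊆ φ.target) :
    NoHoles {z | z ∈ φ.source ∧ green c (φ z) < h} := by
  refine noHoles_of_hasLogOn fun a ha K hKG hK => ?_
  have hKs : K ⊆ φ.source := fun z hz => (hKG hz).1
  -- Since a lies outside the region, w ↦ φ⁻¹(w) - a has no zero on the disk of the polynomial. A
  -- logarithm of it, composed with φ, is one of z - a.
  obtain ⟨L, hL, hexp⟩ := hasLogOn_of_subset_green_lt h0 hh (K := φ '' K)
    (hK.image_of_continuousOn (φ.continuousOn.mono hKs))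
    (by rintro _ ⟨z, hz, rfl⟩; exact (hKG hz).2) (F := fun w => φ.symm w - a)
    ((φ.continuousOn_symm.mono hφ).sub continuousOn_const) (fun w hw hwa => by
      apply ha
      rw [← sub_eq_zero.1 hwa]
      exact ⟨φ.map_target (hφ hw), by rwa [φ.right_inv (hφ hw)]⟩)
  refine ⟨L ∘ φ, hL.comp (φ.continuousOn.mono hKs) (mapsTo_image _ _), fun z hz => ?_⟩
  rw [Function.comp, hexp _ (mem_image_of_mem _ hz)]
  simp only [φ.left_inv (hKs hz)]

/-! ### External rays -/

theorem isOpen_compl_quadFilledJulia (c : ℂ) : IsOpen (quadFilledJulia c)ᶜ := by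
  have : (quadFilledJulia c)ᶜ = {z | green c z ≠ 0} := by
    ext z; rw [mem_compl_iff, mem_quadFilledJulia_iff]; rfl
  rw [this]
  exact isOpen_ne_fun (continuous_green c) continuous_const

theorem quad_mem_quadFilledJulia_iff {c z : ℂ} :
    quad c z ∈ quadFilledJulia c ↔ z ∈ quadFilledJulia c := by
  simp [mem_quadFilledJulia_iff, green_quad]

theorem IsBottcher.iterate {c : ℂ} {B : ℂ → ℂ} (hB : IsBottcher c B) {z : ℂ}
    (hz : z ∈ (quadFilledJulia c)ᶜ) (n : ℕ) :
    (quad c)^[n] z ∈ (quadFilledJulia c)ᶜ ∧ B ((quad c)^[n] z) = B z ^ 2 ^ n := by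
  induction n with
  | zero => exact ⟨hz, by simp⟩
  | succ n ih =>
    rw [Function.iterate_succ_apply']
    refine ⟨fun h => ih.1 (quad_mem_quadFilledJulia_iff.1 h), ?_⟩
    rw [hB.conj _ ih.1, ih.2, ← pow_mul, pow_succ]

/-- Tangency at infinity makes |B| and the norm of the n-th iterate asymptotically equal, while B of
that iterate is B(z)^(2^n); take logarithms and divide by 2^n. -/
theorem IsBottcher.green_eq {c : ℂ} {B : ℂ → ℂ} (hB : IsBottcher c B) {z : ℂ}
    (hz : z ∈ (quadFilledJulia c)ᶜ) : green c z = Real.log ‖B z‖ := by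
  have hesc : Tendsto (fun n : ℕ => (quad c)^[n] z) atTop (cocompact ℂ) := not_not.1 hz
  have hnorm : Tendsto (fun n : ℕ => ‖(quad c)^[n] z‖) atTop atTop := by
    rwa [← Metric.cobounded_eq_cocompact, ← tendsto_norm_atTop_iff_cobounded] at hesc
  have h1 : Tendsto (fun n : ℕ => ‖B ((quad c)^[n] z) / (quad c)^[n] z‖) atTop (𝓝 1) := by
    simpa using (hB.tangent.comp hesc).norm
  have h2 : Tendsto (fun n : ℕ => 1 - greenShift c / (‖(quad c)^[n] z‖ + greenShift c)) atTop
      (𝓝 1) := by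
    simpa using (tendsto_const_nhds (x := (1 : ℝ))).sub
      ((tendsto_const_nhds (x := greenShift c)).div_atTop
        (tendsto_atTop_add_const_right _ (greenShift c) hnorm))
  have h3 := ((h1.mul h2).log (by norm_num)).mul (tendsto_div_two_pow 1)
  rw [mul_zero] at h3
  have h4 := (tendsto_greenApprox c z).add h3
  rw [add_zero] at h4
  refine tendsto_nhds_unique h4 (tendsto_const_nhds.congr' ?_)
  filter_upwards [hnorm.eventually_gt_atTop 0] with n hn
  have hBn : B ((quad c)^[n] z) = B z ^ 2 ^ n := (hB.iterate hz n).2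
  have hBpos : 0 < ‖B z‖ := zero_lt_one.trans (hB.bij.mapsTo hz)
  have hM := norm_add_greenShift_pos c ((quad c)^[n] z)
  have h5 : ‖B ((quad c)^[n] z) / (quad c)^[n] z‖ *
      (1 - greenShift c / (‖(quad c)^[n] z‖ + greenShift c)) =
      ‖B z‖ ^ 2 ^ n / (‖(quad c)^[n] z‖ + greenShift c) := by
    rw [hBn, norm_div, norm_pow]
    field_simp
    ring
  rw [h5, Real.log_div (pow_pos hBpos _).ne' hM.ne', Real.log_pow, greenApprox]
  push_cast
  field_simp
  ring

theorem norm_mul_exp_turn {r : ℝ} (hr : 1 < r) (θ : ℝ) :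
    ‖(r * Complex.exp (2 * Real.pi * θ * Complex.I) : ℂ)‖ = r := by
  have : (2 * Real.pi * θ * Complex.I : ℂ) = ((2 * Real.pi * θ : ℝ) : ℂ) * Complex.I := by
    push_cast; ring
  rw [norm_mul, this, Complex.norm_exp_ofReal_mul_I, mul_one, Complex.norm_real,
    Real.norm_of_nonneg (by linarith)]

theorem IsBottcher.externalRay_eq {c : ℂ} {B : ℂ → ℂ} (hB : IsBottcher c B) (θ : ℝ) :
    externalRay c B θ = (fun r : ℝ => Function.invFunOn B (quadFilledJulia c)ᶜ
      (r * Complex.exp (2 * Real.pi * θ * Complex.I))) '' Ioi 1 := by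
  have hnorm : ∀ r : ℝ, 1 < r →
      (r * Complex.exp (2 * Real.pi * θ * Complex.I) : ℂ) ∈ {w : ℂ | 1 < ‖w‖} := by
    intro r hr
    rw [mem_ofPred_eq, norm_mul_exp_turn hr]
    exact hr
  ext z
  constructor
  · rintro ⟨hz, r, hr, hzr⟩
    exact ⟨r, hr, by simp only; rw [← hzr, hB.bij.injOn.leftInvOn_invFunOn hz]⟩
  · rintro ⟨r, hr, rfl⟩
    exact ⟨hB.bij.surjOn.mapsTo_invFunOn (hnorm r hr), r, hr,
      hB.bij.surjOn.rightInvOn_invFunOn (hnorm r hr)⟩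

theorem IsBottcher.isPreconnected_externalRay {c : ℂ} {B : ℂ → ℂ} (hB : IsBottcher c B) (θ : ℝ) :
    IsPreconnected (externalRay c B θ) := by
  rw [hB.externalRay_eq]
  refine isPreconnected_Ioi.image _ ?_
  refine (continuousOn_invFunOn (isOpen_compl_quadFilledJulia c) hB.holo hB.bij).comp
    (by fun_prop) fun r hr => ?_
  rw [mem_ofPred_eq, norm_mul_exp_turn hr]
  exact hr

/-- An external ray contains points of any positive potential. -/
theorem IsBottcher.exists_mem_externalRay {c : ℂ} {B : ℂ → ℂ} (hB : IsBottcher c B) (θ : ℝ)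
    {h : ℝ} (hh : 0 < h) : ∃ z ∈ externalRay c B θ, green c z = h := by
  have hr : 1 < Real.exp h := Real.one_lt_exp_iff.2 hh
  obtain ⟨z, hz, hzr⟩ := hB.bij.surjOn
    (show (Real.exp h * Complex.exp (2 * Real.pi * θ * Complex.I) : ℂ) ∈ {w : ℂ | 1 < ‖w‖} by
      rw [mem_ofPred_eq, norm_mul_exp_turn hr]; exact hr)
  exact ⟨z, ⟨hz, _, hr, hzr⟩, by rw [hB.green_eq hz, hzr, norm_mul_exp_turn hr, Real.log_exp]⟩

theorem IsBottcher.quad_mem_externalRay {c : ℂ} {B : ℂ → ℂ} (hB : IsBottcher c B) {θ : ℝ} {z : ℂ}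
    (hz : z ∈ externalRay c B θ) : quad c z ∈ externalRay c B (2 * θ) := by
  obtain ⟨hzK, r, hr, hzr⟩ := hz
  refine ⟨fun h => hzK (quad_mem_quadFilledJulia_iff.1 h), r ^ 2, by nlinarith, ?_⟩
  rw [hB.conj z hzK, hzr, mul_pow, ← Complex.exp_nat_mul]
  push_cast
  congr 2
  ring

theorem IsBottcher.exists_quad_eq_of_mem_externalRay {c : ℂ} {B : ℂ → ℂ} (hB : IsBottcher c B)
    {θ : ℝ} {z : ℂ} (hz : z ∈ externalRay c B (2 * θ)) :
    ∃ y ∈ externalRay c B θ, quad c y = z := by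
  obtain ⟨hzK, r, hr, hzr⟩ := hz
  have hs : 1 < √r := by rw [Real.lt_sqrt zero_le_one]; simpa using hr
  obtain ⟨y, hy, hyr⟩ := hB.bij.surjOn
    (show (√r * Complex.exp (2 * Real.pi * θ * Complex.I) : ℂ) ∈ {w : ℂ | 1 < ‖w‖} by
      rw [mem_ofPred_eq, norm_mul_exp_turn hs]; exact hs)
  refine ⟨y, ⟨hy, _, hs, hyr⟩, ?_⟩
  refine hB.bij.injOn (fun h => hy (quad_mem_quadFilledJulia_iff.1 h)) hzK ?_
  rw [hB.conj y hy, hyr, hzr, mul_pow, ← Complex.exp_nat_mul, ← Complex.ofReal_pow,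
    Real.sq_sqrt (by linarith)]
  push_cast
  congr 2
  ring

/-- The union of the rays that land at a fixed point is forward invariant. -/
theorem quad_mem_raysLandingAt {c a : ℂ} (ha : quad c a = a) {z : ℂ}
    (hz : z ∈ raysLandingAt c a) : quad c z ∈ raysLandingAt c a := by
  obtain ⟨B, θ, hB, hland, hz⟩ := hz
  refine ⟨B, 2 * θ, hB, fun ε hε => ?_, hB.quad_mem_externalRay hz⟩
  obtain ⟨ε', hε', hcont⟩ := Metric.continuousAt_iff.1 ((continuous_quad c).continuousAt (x := a)) ε hε
  obtain ⟨δ, hδ, hδ'⟩ := hland ε' hε'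
  -- Each point of the doubled ray has a preimage on the original ray with half its potential, and q
  -- is continuous at its fixed point a.
  refine ⟨2 * δ, by positivity, fun w hw hwδ => ?_⟩
  obtain ⟨y, hy, rfl⟩ := hB.exists_quad_eq_of_mem_externalRay hw
  rw [green_quad] at hwδ
  have := hcont (hδ' y hy (by linarith))
  rwa [ha] at this

theorem quad_mem_closure_raysLandingAt {c a : ℂ} (ha : quad c a = a) {z : ℂ}
    (hz : z ∈ closure (raysLandingAt c a)) : quad c z ∈ closure (raysLandingAt c a) :=
  map_mem_closure (continuous_quad c) hz fun _ => quad_mem_raysLandingAt ha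

/-! ### The disk cut along the rays -/

/-- The disk bounded by the equipotential of level `h` of `quad c`, cut along the rays landing at
`a`. -/
def quadCutDomain (c a : ℂ) (h : ℝ) : Set ℂ :=
  {w | green c w < h ∧ w ∉ closure (raysLandingAt c a)}

theorem isOpen_quadCutDomain (c a : ℂ) (h : ℝ) : IsOpen (quadCutDomain c a h) :=
  (isOpen_green_lt c h).inter isClosed_closure.isOpen_compl

theorem cutDomain_eq (c : ℂ) (φ : OpenPartialHomeomorph ℂ ℂ) (α : ℂ) (h : ℝ) :
    cutDomain c φ α h = φ.source ∩ φ ⁻¹' quadCutDomain c (φ α) h := rfl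

theorem cutDomain_refl (c a : ℂ) (h : ℝ) :
    cutDomain c (OpenPartialHomeomorph.refl ℂ) a h = quadCutDomain c a h := by
  ext z; simp [cutDomain, quadCutDomain]

/-- A hole lies in the disk bounded by the equipotential, so it must meet the closure of the rays. A
ray entering the open union of domain and hole there can only be in the hole. Being connected, it
stays in this compact set, yet it has a point of potential h. -/
theorem noHoles_cutDomain {c : ℂ} (h0 : (0 : ℂ) ∈ quadFilledJulia c) {h : ℝ}
    (hh : 0 < h) (φ : OpenPartialHomeomorph ℂ ℂ) (hφ : {w | green c w < h} ⊆ φ.target) (α : ℂ) :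
    NoHoles (cutDomain c φ α h) := by
  intro C hC hd ho
  set V : Set ℂ := {z | z ∈ φ.source ∧ green c (φ z) < h} with hV
  have hVo : IsOpen V := φ.isOpen_inter_preimage (isOpen_green_lt c h)
  have hDV : cutDomain c φ α h ⊆ V := fun z hz => ⟨hz.1, hz.2.1⟩
  have hCV : C ⊆ V := by
    rw [← sdiff_eq_empty]
    refine noHoles_green_comp_lt h0 hh φ hφ _ (hC.diff hVo) disjoint_sdiff_left ?_
    have : V ∪ C \ V = V ∪ (cutDomain c φ α h ∪ C) := by
      ext x; simp only [mem_union, Set.mem_sdiff]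
      have := @hDV x
      tauto
    change IsOpen (V ∪ C \ V)
    rw [this]
    exact hVo.union ho
  by_contra hne
  obtain ⟨z, hz⟩ := nonempty_iff_ne_empty.2 hne
  have hzR : φ z ∈ closure (raysLandingAt c (φ α)) := by
    by_contra h
    exact disjoint_left.1 hd hz ⟨(hCV hz).1, (hCV hz).2, h⟩
  have hsub : cutDomain c φ α h ∪ C ⊆ φ.source :=
    union_subset (fun z hz => hz.1) fun z hz => (hCV hz).1
  have hio : IsOpen (φ '' (cutDomain c φ α h ∪ C)) := φ.isOpen_image_of_subset_source ho hsub
  have hC' : IsCompact (φ '' C) :=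
    hC.image_of_continuousOn (φ.continuousOn.mono fun z hz => (hCV hz).1)
  have hstay : ∀ y ∈ raysLandingAt c (φ α), y ∈ φ '' (cutDomain c φ α h ∪ C) → y ∈ φ '' C := by
    rintro _ hy ⟨x, hx | hx, rfl⟩
    · exact absurd (subset_closure hy) hx.2.2
    · exact ⟨x, hx, rfl⟩
  obtain ⟨y, hyO, hyR⟩ := mem_closure_iff.1 hzR _ hio ⟨z, Or.inr hz, rfl⟩
  obtain ⟨B, θ, hB, hland, hy⟩ := hyR
  have hray : ∀ y ∈ externalRay c B θ, y ∈ raysLandingAt c (φ α) :=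
    fun y hy => ⟨B, θ, hB, hland, hy⟩
  obtain ⟨w, hw, hwh⟩ := hB.exists_mem_externalRay θ hh
  have hwC : w ∉ φ '' C := by
    rintro ⟨x, hx, rfl⟩
    exact (hCV hx).2.ne hwh
  obtain ⟨v, hv, hvO, hvC⟩ := hB.isPreconnected_externalRay θ _ _ hio hC'.isClosed.isOpen_compl
    (fun v _ => by
      by_cases hvC : v ∈ φ '' C
      · exact Or.inl (image_mono subset_union_right hvC)
      · exact Or.inr hvC) ⟨y, hy, hyO⟩ ⟨w, hw, hwC⟩
  exact hvC (hstay v (hray v hv) hvO)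

theorem noHoles_quadCutDomain {c : ℂ} (h0 : (0 : ℂ) ∈ quadFilledJulia c) {h : ℝ}
    (hh : 0 < h) (a : ℂ) : NoHoles (quadCutDomain c a h) := by
  rw [← cutDomain_refl]
  exact noHoles_cutDomain h0 hh _ (by simp) a

/-! ### Pulling back along a quadratic-like map -/

/-- A quadratic-like map with connected filled Julia set, a conjugacy with a quadratic polynomial,
a fixed point and an admissible level: the data that determine a puzzle. -/
structure IsPuzzleSetting (f : ℂ → ℂ) (U' U : Set ℂ) (c : ℂ) (φ : OpenPartialHomeomorph ℂ ℂ)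
    (α : ℂ) (h : ℝ) : Prop where
  quadLike : IsQuadraticLike f U' U
  connected : IsConnected (filledJulia f U')
  conjugacy : IsConjugacy f U' c φ
  fixed_mem : α ∈ filledJulia f U'
  fixed : f α = α
  level : IsAdmissibleLevel f c φ h

namespace IsQuadraticLike

variable {f : ℂ → ℂ} {U' U : Set ℂ} (hf : IsQuadraticLike f U' U)

include hf

theorem eq_zero_of_apply_eq {z : ℂ} (hz : z ∈ U') (hz0 : f z = f 0) : z = 0 := by
  have : z ∈ U' ∩ f ⁻¹' {f 0} := ⟨hz, hz0⟩
  rwa [hf.covering.fiber_critical] at this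

theorem finite_fiber (w : ℂ) : (U' ∩ f ⁻¹' {w}).Finite ∧ (U' ∩ f ⁻¹' {w}).ncard ≤ 2 := by
  by_cases hw : w ∈ U
  · by_cases hw0 : w = f 0
    · rw [hw0, hf.covering.fiber_critical]; simp
    · have := hf.covering.fiber w hw hw0
      exact ⟨finite_of_ncard_ne_zero (by omega), this.le⟩
  · have : U' ∩ f ⁻¹' {w} = ∅ := by
      rw [eq_empty_iff_forall_notMem]
      rintro z ⟨hz, rfl⟩
      exact hw (hf.covering.mapsTo hz)
    rw [this]; simp

/-- Among three points of a fiber, two coincide. -/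
theorem fiber_trichotomy {x y z : ℂ} (hx : x ∈ U') (hy : y ∈ U') (hz : z ∈ U')
    (hxy : f x = f y) (hxz : f x = f z) : x = y ∨ x = z ∨ y = z := by
  by_contra! hne
  obtain ⟨hfin, hcard⟩ := hf.finite_fiber (f x)
  have hsub : {x, y, z} ⊆ U' ∩ f ⁻¹' {f x} := by
    rintro t (rfl | rfl | rfl)
    exacts [⟨hx, rfl⟩, ⟨hy, hxy.symm⟩, ⟨hz, hxz.symm⟩]
  have h3 := ncard_le_ncard hsub hfin
  rw [ncard_eq_three.2 ⟨x, y, z, hne.1, hne.2.1, hne.2.2, rfl⟩] at h3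
  omega

theorem isOpen_image : ∀ O ⊆ U', IsOpen O → IsOpen (f '' O) :=
  isOpen_image_of_finite_fibers hf.disk_dom.isOpen hf.covering.holo fun w => (hf.finite_fiber w).1

theorem continuousOn : ContinuousOn f U' := hf.covering.holo.continuousOn

theorem differentiableAt {z : ℂ} (hz : z ∈ U') : DifferentiableAt ℂ f z :=
  hf.covering.holo.differentiableAt (hf.disk_dom.isOpen.mem_nhds hz)

theorem deriv_iterate {z : ℂ} {k : ℕ} (hz : ∀ j < k, f^[j] z ∈ U') :
    DifferentiableAt ℂ f^[k] z ∧ (deriv f^[k] z = 0 ↔ ∃ j < k, f^[j] z = 0) := by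
  induction k generalizing z with
  | zero => simp [deriv_id]
  | succ k ih =>
    have hz0 : z ∈ U' := hz 0 k.succ_pos
    obtain ⟨h1, h2⟩ := ih (z := f z) fun j hj => by
      simpa using hz (j + 1) (by omega)
    have hd := hf.differentiableAt hz0
    rw [Function.iterate_succ]
    refine ⟨h1.comp z hd, ?_⟩
    rw [deriv_comp z h1 hd, mul_eq_zero, h2, hf.covering.critical z hz0]
    constructor
    · rintro (⟨j, hj, hj0⟩ | h0)
      · exact ⟨j + 1, by omega, by simpa using hj0⟩
      · exact ⟨0, by omega, by simpa using h0⟩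
    · rintro ⟨_ | j, hj, hj0⟩
      · exact Or.inr (by simpa using hj0)
      · exact Or.inl ⟨j, by omega, by simpa using hj0⟩

end IsQuadraticLike

theorem iteratePreimage_add (f : ℂ → ℂ) (U' : Set ℂ) (n l : ℕ) (S : Set ℂ) :
    iteratePreimage f U' (n + l) S =
      {z | (∀ k < l, f^[k] z ∈ U') ∧ f^[l] z ∈ iteratePreimage f U' n S} := by
  ext z
  simp only [iteratePreimage, mem_ofPred_eq, ← Function.iterate_add_apply]
  constructor
  · rintro ⟨h1, h2⟩
    exact ⟨fun k hk => h1 k (by omega), fun k hk => h1 _ (by omega), h2⟩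
  · rintro ⟨h1, h2, h3⟩
    refine ⟨fun k hk => ?_, h3⟩
    rcases lt_or_ge k l with hkl | hkl
    · exact h1 k hkl
    · simpa [Nat.sub_add_cancel hkl] using h2 (k - l) (by omega)

theorem iteratePreimage_succ (f : ℂ → ℂ) (U' : Set ℂ) (n : ℕ) (S : Set ℂ) :
    iteratePreimage f U' (n + 1) S = U' ∩ f ⁻¹' iteratePreimage f U' n S := by
  rw [iteratePreimage_add]
  ext z
  simp

namespace IsPuzzleSetting

variable {f : ℂ → ℂ} {U' U : Set ℂ} {c : ℂ} {φ : OpenPartialHomeomorph ℂ ℂ} {α : ℂ} {h : ℝ}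
  (S : IsPuzzleSetting f U' U c φ α h)

include S

theorem source_subset_dom : φ.source ⊆ U' := S.conjugacy.source_subset

theorem source_subset_range : φ.source ⊆ U :=
  S.source_subset_dom.trans (subset_closure.trans S.quadLike.subset)

theorem zero_mem : (0 : ℂ) ∈ quadFilledJulia c := by
  apply zero_mem_quadFilledJulia
  rw [← S.conjugacy.image]
  exact S.connected.image _ (φ.continuousOn.mono S.conjugacy.filledJulia_subset)

theorem quad_fixed : quad c (φ α) = φ α := by
  have hα : α ∈ φ.source := S.conjugacy.filledJulia_subset S.fixed_mem
  have := S.conjugacy.conj α hα (by rwa [S.fixed])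
  rw [← this, S.fixed]

theorem mem_target {y : ℂ} (hy : green c y ≤ h) : y ∈ φ.target := S.level.subset_target hy

theorem apply_symm {y : ℂ} (hy : green c y ≤ h) :
    f (φ.symm y) ∈ φ.source ∧ φ (f (φ.symm y)) = quad c y := by
  have hs := φ.map_target (S.mem_target hy)
  have hr := φ.right_inv (S.mem_target hy)
  have h1 := S.level.image_mem _ hs (by rwa [hr])
  exact ⟨h1, by rw [S.conjugacy.conj _ hs h1, hr]⟩

theorem apply_symm_neg {y : ℂ} (hy : green c y ≤ h) : f (φ.symm (-y)) = f (φ.symm y) := by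
  have h1 := S.apply_symm hy
  have h2 := S.apply_symm (y := -y) (by rwa [green_neg])
  exact φ.injOn h2.1 h1.1 (by rw [h1.2, h2.2, quad_neg])

/-- The conjugacy is only topological, so critical points are matched by counting preimages. If
φ⁻¹(0) were not 0, its image would have a second preimage z₁. For small y ≠ 0, the distinct points
φ⁻¹(±y) have a common image, which by openness of f also has a preimage near z₁: three points in one
fiber. -/
theorem symm_zero : φ.symm 0 = 0 := by
  by_contra hne
  have h0h : green c 0 ≤ h := by
    rw [mem_quadFilledJulia_iff.1 S.zero_mem]; exact S.level.pos.le
  have h0t := S.mem_target h0h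
  have hz₀ : φ.symm 0 ∈ U' := S.source_subset_dom (φ.map_target h0t)
  have hw : f (φ.symm 0) ∈ U := S.quadLike.covering.mapsTo hz₀
  obtain ⟨z₁, hz₁, hfz₁, hz₁₀⟩ : ∃ z₁ ∈ U', f z₁ = f (φ.symm 0) ∧ z₁ ≠ φ.symm 0 := by
    have hcard := S.quadLike.covering.fiber _ hw
      (fun he => hne (S.quadLike.eq_zero_of_apply_eq hz₀ he))
    obtain ⟨z₁, ⟨hz₁, hfz₁⟩, h1⟩ := exists_ne_of_one_lt_ncard (hcard ▸ one_lt_two) (φ.symm 0)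
    exact ⟨z₁, hz₁, hfz₁, h1⟩
  obtain ⟨N₀, N₁, hN₀, hN₁, hm₀, hm₁, hdis⟩ := t2_separation hz₁₀.symm
  have hcont : ContinuousAt φ.symm 0 := φ.continuousAt_symm h0t
  have hneg : ContinuousAt (fun y => φ.symm (-y)) 0 := by
    refine ContinuousAt.comp (g := φ.symm) ?_ continuousAt_neg
    rwa [neg_zero]
  have e1 : ∀ᶠ y in 𝓝 0, φ.symm y ∈ N₀ := hcont.eventually_mem (hN₀.mem_nhds hm₀)
  have e2 : ∀ᶠ y in 𝓝 0, φ.symm (-y) ∈ N₀ :=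
    hneg.eventually_mem (hN₀.mem_nhds (by rwa [neg_zero]))
  have e3 : ∀ᶠ y in 𝓝 0, f (φ.symm y) ∈ f '' (N₁ ∩ U') := by
    have hc : ContinuousAt (fun y => f (φ.symm y)) 0 :=
      ContinuousAt.comp (g := f) (S.quadLike.differentiableAt hz₀).continuousAt hcont
    refine hc.eventually_mem (IsOpen.mem_nhds ?_ ⟨z₁, ⟨hm₁, hz₁⟩, hfz₁⟩)
    exact S.quadLike.isOpen_image _ inter_subset_right (hN₁.inter S.quadLike.disk_dom.isOpen)
  have e4 : ∀ᶠ y in 𝓝 0, green c y < h := by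
    refine (continuous_green c).continuousAt.eventually_lt continuousAt_const ?_
    rw [mem_quadFilledJulia_iff.1 S.zero_mem]; exact S.level.pos
  obtain ⟨y, ⟨h1, h2, ⟨x, ⟨hxN, hxU⟩, hx⟩, h4⟩, hy0⟩ :=
    (((e1.and (e2.and (e3.and e4))).filter_mono nhdsWithin_le_nhds).and
      (self_mem_nhdsWithin : ∀ᶠ y : ℂ in 𝓝[≠] 0, y ∈ ({0}ᶜ : Set ℂ))).exists
  have hyt := S.mem_target h4.le
  have hyt' := S.mem_target (y := -y) (by rw [green_neg]; exact h4.le)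
  rcases S.quadLike.fiber_trichotomy (S.source_subset_dom (φ.map_target hyt))
    (S.source_subset_dom (φ.map_target hyt')) hxU (S.apply_symm_neg h4.le).symm hx.symm
    with he | he | he
  · have := φ.symm.injOn hyt hyt' he
    exact hy0 (self_eq_neg.1 this)
  · exact disjoint_left.1 hdis h1 (he ▸ hxN)
  · exact disjoint_left.1 hdis h2 (he ▸ hxN)

/-- The preimage of the disk bounded by `f E` is the disk bounded by `E`. -/
theorem mem_of_apply_mem {z : ℂ} (hz : z ∈ U') (hfz : f z ∈ φ.source)
    (hgreen : green c (φ (f z)) ≤ 2 * h) : z ∈ φ.source ∧ φ (f z) = quad c (φ z) := by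
  obtain ⟨y, hy⟩ := exists_quad_eq c (φ (f z))
  have hyh : green c y ≤ h := by
    rw [← hy, green_quad] at hgreen; linarith
  have hyt := S.mem_target hyh
  have hyt' := S.mem_target (y := -y) (by rwa [green_neg])
  have hfy : f (φ.symm y) = f z :=
    φ.injOn (S.apply_symm hyh).1 hfz (by rw [(S.apply_symm hyh).2, hy])
  -- The points φ⁻¹(±y) exhaust the fiber when they differ. If they coincide, then y = 0 and the
  -- fiber is that of the critical value, a single point.
  have key : z = φ.symm y ∨ z = φ.symm (-y) := by
    rcases S.quadLike.fiber_trichotomy hz (S.source_subset_dom (φ.map_target hyt))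
      (S.source_subset_dom (φ.map_target hyt')) hfy.symm
      (hfy.symm.trans (S.apply_symm_neg hyh).symm) with he | he | he
    · exact Or.inl he
    · exact Or.inr he
    · have hy0 : y = 0 := self_eq_neg.1 (φ.symm.injOn hyt hyt' he)
      subst hy0
      left
      rw [S.symm_zero] at hfy ⊢
      exact S.quadLike.eq_zero_of_apply_eq hz hfy.symm
  rcases key with rfl | rfl
  · exact ⟨φ.map_target hyt, by rw [φ.right_inv hyt, hy]⟩
  · exact ⟨φ.map_target hyt', by rw [φ.right_inv hyt', quad_neg, hy]⟩

theorem quadCutDomain_invariant {y : ℂ} (hy : quad c y ∈ quadCutDomain c (φ α) h) :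
    y ∈ quadCutDomain c (φ α) h := by
  refine ⟨?_, fun hcl => hy.2 (quad_mem_closure_raysLandingAt S.quad_fixed hcl)⟩
  have := hy.1
  rw [green_quad] at this
  linarith [green_nonneg c y]

/-- Points of the m-th preimage have potential below h / 2^m, so each backward step stays where
`mem_of_apply_mem` applies. Every depth is thereby transported to the dynamical plane of the
polynomial. -/
theorem iteratePreimage_eq (m : ℕ) : iteratePreimage f U' m (cutDomain c φ α h) =
    φ.source ∩ φ ⁻¹' ((quad c)^[m] ⁻¹' quadCutDomain c (φ α) h) := by
  induction m with
  | zero => ext z; simp [iteratePreimage, cutDomain_eq]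
  | succ m ih =>
    rw [iteratePreimage_succ, ih]
    ext z
    simp only [mem_inter_iff, mem_preimage, Function.iterate_succ_apply]
    constructor
    · rintro ⟨hz, hfz, hm⟩
      have hlt : green c (φ (f z)) ≤ 2 * h := by
        have h1 := hm.1
        rw [green_quad_iterate] at h1
        have h2 : (1 : ℝ) ≤ 2 ^ m := one_le_pow₀ one_le_two
        nlinarith [green_nonneg c (φ (f z)), S.level.pos]
      obtain ⟨h1, h2⟩ := S.mem_of_apply_mem hz hfz hlt
      exact ⟨h1, h2 ▸ hm⟩
    · rintro ⟨hz, hm⟩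
      have hlt : green c (φ z) ≤ h := by
        have h1 := hm.1
        rw [green_quad_iterate, green_quad] at h1
        have h2 : (1 : ℝ) ≤ 2 ^ m := one_le_pow₀ one_le_two
        nlinarith [green_nonneg c (φ z), S.level.pos]
      have hfz := S.level.image_mem z hz hlt
      exact ⟨S.source_subset_dom hz, hfz, by rwa [S.conjugacy.conj z hz hfz]⟩

/-- The Markov property of the puzzle: forward invariance of the rays and doubling of the potential
show that a point whose image lies in the cut disk lies there too. -/
theorem antitone_iteratePreimage :
    Antitone fun m => iteratePreimage f U' m (cutDomain c φ α h) := by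
  refine antitone_nat_of_succ_le fun m => ?_
  simp only [S.iteratePreimage_eq]
  rintro z ⟨hz, hm⟩
  refine ⟨hz, ?_⟩
  rw [mem_preimage, mem_preimage, Function.iterate_succ_apply'] at hm
  exact S.quadCutDomain_invariant hm

theorem isOpen_iteratePreimage (m : ℕ) : IsOpen (iteratePreimage f U' m (cutDomain c φ α h)) := by
  rw [S.iteratePreimage_eq]
  exact φ.isOpen_inter_preimage
    ((isOpen_quadCutDomain c (φ α) h).preimage (continuous_quad_iterate c m))

theorem iteratePreimage_subset_source (m : ℕ) :
    iteratePreimage f U' m (cutDomain c φ α h) ⊆ φ.source := by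
  rw [S.iteratePreimage_eq]
  exact inter_subset_left

theorem noHoles_iteratePreimage (m : ℕ) :
    NoHoles (iteratePreimage f U' m (cutDomain c φ α h)) := by
  induction m with
  | zero =>
    have : iteratePreimage f U' 0 (cutDomain c φ α h) = cutDomain c φ α h := by
      ext z; simp [iteratePreimage]
    rw [this]
    exact noHoles_cutDomain S.zero_mem S.level.pos φ
      (fun w hw => S.mem_target (le_of_lt hw)) α
  | succ m ih =>
    rw [iteratePreimage_succ]
    exact S.quadLike.disk_dom.noHoles.pullback S.quadLike.disk_dom.isOpen ih
      (S.isOpen_iteratePreimage m) S.quadLike.continuousOn S.quadLike.isOpen_image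

theorem isTopologicalDisk_component {m : ℕ} {z : ℂ}
    (hz : z ∈ iteratePreimage f U' m (cutDomain c φ α h)) :
    IsTopologicalDisk (connectedComponentIn (iteratePreimage f U' m (cutDomain c φ α h)) z) :=
  ⟨(S.isOpen_iteratePreimage m).connectedComponentIn, isConnected_connectedComponentIn_iff.2 hz,
    ((S.noHoles_iteratePreimage m).connectedComponentIn (S.isOpen_iteratePreimage m)
      z).isConnected_compl (S.isOpen_iteratePreimage m).connectedComponentIn⟩

/-! ### Components of the iterated preimages -/

theorem mapsTo_component {m : ℕ} {z : ℂ}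
    (hz : z ∈ iteratePreimage f U' (m + 1) (cutDomain c φ α h)) :
    MapsTo f (connectedComponentIn (iteratePreimage f U' (m + 1) (cutDomain c φ α h)) z)
      (connectedComponentIn (iteratePreimage f U' m (cutDomain c φ α h)) (f z)) := by
  rw [mapsTo_iff_image_subset]
  have hsub := connectedComponentIn_subset
    (iteratePreimage f U' (m + 1) (cutDomain c φ α h)) z
  refine IsPreconnected.subset_connectedComponentIn ?_ ⟨z, mem_connectedComponentIn hz, rfl⟩ ?_
  · refine isPreconnected_connectedComponentIn.image _ (S.quadLike.continuousOn.mono ?_)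
    exact hsub.trans ((S.iteratePreimage_subset_source _).trans S.source_subset_dom)
  · rintro _ ⟨x, hx, rfl⟩
    have := hsub hx
    rw [iteratePreimage_succ] at this
    exact this.2

theorem isCompact_component_inter_preimage {m : ℕ} {z : ℂ} {C : Set ℂ} (hC : IsCompact C)
    (hCm : C ⊆ iteratePreimage f U' m (cutDomain c φ α h)) :
    IsCompact (connectedComponentIn (iteratePreimage f U' (m + 1) (cutDomain c φ α h)) z ∩
      f ⁻¹' C) := by
  have hcomp : IsCompact (U' ∩ f ⁻¹' C) := S.quadLike.covering.proper C
    (hCm.trans ((S.iteratePreimage_subset_source m).trans S.source_subset_range)) hC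
  -- The other components have an open union; removing it from the compact preimage in U' leaves a
  -- compact set, so properness passes to a single component.
  have heq : connectedComponentIn (iteratePreimage f U' (m + 1) (cutDomain c φ α h)) z ∩ f ⁻¹' C =
      (U' ∩ f ⁻¹' C) \ (iteratePreimage f U' (m + 1) (cutDomain c φ α h) \
        connectedComponentIn (iteratePreimage f U' (m + 1) (cutDomain c φ α h)) z) := by
    ext x
    have h1 := @connectedComponentIn_subset _ _
      (iteratePreimage f U' (m + 1) (cutDomain c φ α h)) z x
    have h2 : x ∈ iteratePreimage f U' (m + 1) (cutDomain c φ α h) → x ∈ U' := fun h =>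
      S.source_subset_dom (S.iteratePreimage_subset_source _ h)
    have h3 : x ∈ U' → x ∈ f ⁻¹' C → x ∈ iteratePreimage f U' (m + 1) (cutDomain c φ α h) := by
      rw [iteratePreimage_succ]; exact fun h h' => ⟨h, hCm h'⟩
    simp only [mem_inter_iff, Set.mem_sdiff]
    tauto
  rw [heq]
  exact hcomp.diff (isOpen_diff_connectedComponentIn (S.isOpen_iteratePreimage _) z)

/-- The image of the component is open because f is open, and relatively closed in the target
component because f is proper; the target is connected. -/
theorem image_component {m : ℕ} {z : ℂ}
    (hz : z ∈ iteratePreimage f U' (m + 1) (cutDomain c φ α h)) :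
    f '' connectedComponentIn (iteratePreimage f U' (m + 1) (cutDomain c φ α h)) z =
      connectedComponentIn (iteratePreimage f U' m (cutDomain c φ α h)) (f z) := by
  set P := connectedComponentIn (iteratePreimage f U' (m + 1) (cutDomain c φ α h)) z with hP
  set P₁ := connectedComponentIn (iteratePreimage f U' m (cutDomain c φ α h)) (f z) with hP₁
  have hPU : P ⊆ U' := (connectedComponentIn_subset _ _).trans
    ((S.iteratePreimage_subset_source _).trans S.source_subset_dom)
  have hP₁o : IsOpen P₁ := (S.isOpen_iteratePreimage m).connectedComponentIn
  have hopen : IsOpen (f '' P) :=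
    S.quadLike.isOpen_image P hPU (S.isOpen_iteratePreimage _).connectedComponentIn
  refine Subset.antisymm (S.mapsTo_component hz).image_subset ?_
  have hpre : IsPreconnected P₁ := isPreconnected_connectedComponentIn
  refine hpre.subset_of_closure_inter_subset hopen
    ⟨f z, ?_, z, mem_connectedComponentIn hz, rfl⟩ ?_
  · exact (S.mapsTo_component hz) (mem_connectedComponentIn hz)
  · rintro w ⟨hwcl, hw⟩
    obtain ⟨r, hr, hball⟩ := Metric.nhds_basis_closedBall.mem_iff.1 (hP₁o.mem_nhds hw)
    have hC : IsCompact (P ∩ f ⁻¹' Metric.closedBall w r) :=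
      S.isCompact_component_inter_preimage (isCompact_closedBall w r)
        (hball.trans (connectedComponentIn_subset _ _))
    have himg : IsClosed (f '' (P ∩ f ⁻¹' Metric.closedBall w r)) :=
      (hC.image_of_continuousOn (S.quadLike.continuousOn.mono (inter_subset_left.trans hPU))).isClosed
    rw [image_inter_preimage] at himg
    have : w ∈ closure (f '' P ∩ Metric.closedBall w r) := by
      rw [mem_closure_iff_nhds]
      intro N hN
      obtain ⟨x, ⟨hx1, hx2⟩, hx3⟩ := mem_closure_iff_nhds.1 hwcl _
        (inter_mem hN (Metric.closedBall_mem_nhds w hr))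
      exact ⟨x, hx1, hx3, hx2⟩
    rw [himg.closure_eq] at this
    exact this.1

theorem image_iterate_component {m k : ℕ} {z : ℂ}
    (hz : z ∈ iteratePreimage f U' (m + k) (cutDomain c φ α h)) :
    f^[k] '' connectedComponentIn (iteratePreimage f U' (m + k) (cutDomain c φ α h)) z =
      connectedComponentIn (iteratePreimage f U' m (cutDomain c φ α h)) (f^[k] z) := by
  induction k generalizing z with
  | zero => simp
  | succ k ih =>
    rw [← add_assoc] at hz ⊢
    rw [Function.iterate_succ, image_comp, S.image_component hz, Function.comp]
    rw [iteratePreimage_succ] at hz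
    exact ih hz.2

theorem isCompact_component_inter_preimage_iterate {m k : ℕ} {z : ℂ}
    (hz : z ∈ iteratePreimage f U' (m + k) (cutDomain c φ α h)) {C : Set ℂ} (hC : IsCompact C)
    (hCm : C ⊆ connectedComponentIn (iteratePreimage f U' m (cutDomain c φ α h)) (f^[k] z)) :
    IsCompact (connectedComponentIn (iteratePreimage f U' (m + k) (cutDomain c φ α h)) z ∩
      f^[k] ⁻¹' C) := by
  induction k generalizing z with
  | zero =>
    simp only [add_zero, Function.iterate_zero, id, preimage_id] at hCm ⊢
    rwa [inter_eq_self_of_subset_right hCm]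
  | succ k ih =>
    rw [← add_assoc] at hz ⊢
    have hfz : f z ∈ iteratePreimage f U' (m + k) (cutDomain c φ α h) := by
      rw [iteratePreimage_succ] at hz; exact hz.2
    have h1 := S.isCompact_component_inter_preimage (z := z) (ih hfz hCm)
      (inter_subset_left.trans (connectedComponentIn_subset _ _))
    convert h1 using 1
    ext x
    have := fun hx => S.mapsTo_component hz (x := x) hx
    simp only [mem_inter_iff, mem_preimage, Function.iterate_succ_apply]
    tauto

/-- On a component that avoids the critical point, the map is injective. -/
theorem injOn_component {m : ℕ} {z : ℂ}
    (h0 : (0 : ℂ) ∉ connectedComponentIn (iteratePreimage f U' (m + 1) (cutDomain c φ α h)) z) :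
    InjOn f (connectedComponentIn (iteratePreimage f U' (m + 1) (cutDomain c φ α h)) z) := by
  intro x hx x' hx' hfx
  by_contra hne
  set D := iteratePreimage f U' (m + 1) (cutDomain c φ α h) with hD
  set E : Set ℂ := (quad c)^[m + 1] ⁻¹' quadCutDomain c (φ α) h with hE
  have hDE : D = φ.source ∩ φ ⁻¹' E := S.iteratePreimage_eq (m + 1)
  have hEo : IsOpen E := (isOpen_quadCutDomain c (φ α) h).preimage (continuous_quad_iterate c _)
  have hEt : E ⊆ φ.target := by
    intro y hy
    refine S.mem_target ?_
    have h1 := hy.1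
    rw [green_quad_iterate] at h1
    have h2 : (1 : ℝ) ≤ 2 ^ (m + 1) := one_le_pow₀ one_le_two
    nlinarith [green_nonneg c y]
  have hPD : connectedComponentIn D z ⊆ D := connectedComponentIn_subset _ _
  have hsrc : ∀ {y}, y ∈ connectedComponentIn D z → y ∈ φ.source := fun hy =>
    S.iteratePreimage_subset_source _ (hPD hy)
  have hE' : ∀ {y}, y ∈ connectedComponentIn D z → φ y ∈ E := fun hy => by
    have := hPD hy
    rw [hDE] at this
    exact this.2
  -- Conjugated to `quad c`, two distinct points with the same image are opposite. Their component
  -- `P` in the polynomial plane is then symmetric about 0.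
  have hφx : φ x' = -φ x := by
    have hfs : ∀ {y}, y ∈ connectedComponentIn D z → f y ∈ φ.source := fun {y} hy => by
      have := hPD hy
      rw [hD, iteratePreimage_succ] at this
      exact S.iteratePreimage_subset_source _ this.2
    have hq : quad c (φ x') = quad c (φ x) := by
      rw [← S.conjugacy.conj x (hsrc hx) (hfs hx), ← S.conjugacy.conj x' (hsrc hx') (hfs hx'), hfx]
    rcases quad_eq_quad_iff.1 hq with he | he
    · exact absurd (φ.injOn (hsrc hx') (hsrc hx) he).symm hne
    · exact he
  -- the component of `φ x` in the dynamical plane of the polynomial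
  set P := connectedComponentIn E (φ x) with hP
  have hPo : IsOpen P := hEo.connectedComponentIn
  have hPc : IsConnected P := isConnected_connectedComponentIn_iff.2 (hE' hx)
  have hxP : φ x ∈ P := mem_connectedComponentIn (hE' hx)
  have hnegP : -φ x ∈ P := by
    rw [← hφx]
    have : φ '' connectedComponentIn D z ⊆ P := by
      refine IsPreconnected.subset_connectedComponentIn
        (isPreconnected_connectedComponentIn.image _ (φ.continuousOn.mono fun y hy => hsrc hy))
        ⟨x, hx, rfl⟩ ?_
      rintro _ ⟨y, hy, rfl⟩
      exact hE' hy
    exact this ⟨x', hx', rfl⟩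
  -- The symmetry of `E` requires depth at least one: only a positive iterate of `quad c` is even.
  have hnegE : ∀ y ∈ E, -y ∈ E := fun y hy => by
    rw [hE, mem_preimage, quad_iterate_neg c y m.succ_ne_zero]
    exact hy
  have hPneg : ∀ y ∈ P, -y ∈ P := by
    have : (fun y => -y) '' P ⊆ P := by
      refine IsPreconnected.subset_connectedComponentIn
        (hPc.isPreconnected.image _ continuousOn_neg) ⟨-φ x, hnegP, neg_neg _⟩ ?_
      rintro _ ⟨y, hy, rfl⟩
      exact hnegE y (connectedComponentIn_subset _ _ hy)
    exact fun y hy => this ⟨y, hy, rfl⟩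
  have h0P : (0 : ℂ) ∉ P := by
    intro h0P
    apply h0
    have hsub : φ.symm '' P ⊆ connectedComponentIn D x := by
      refine IsPreconnected.subset_connectedComponentIn (hPc.isPreconnected.image _
        (φ.continuousOn_symm.mono ((connectedComponentIn_subset _ _).trans hEt)))
        ⟨φ x, hxP, φ.left_inv (hsrc hx)⟩ ?_
      rintro _ ⟨y, hy, rfl⟩
      have hyE := connectedComponentIn_subset _ _ hy
      rw [hDE]
      exact ⟨φ.map_target (hEt hyE), by rwa [mem_preimage, φ.right_inv (hEt hyE)]⟩
    rw [connectedComponentIn_eq hx, ← S.symm_zero]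
    exact hsub ⟨0, h0P, rfl⟩
  obtain ⟨γ, hγ⟩ := ((hPo.isConnected_iff_isPathConnected.1 hPc).joinedIn _ hxP _ hnegP)
  -- A path from φ x to -φ x together with its reflection is compact, connected and symmetric, as
  -- needed to contradict the logarithm on compact subsets of the hole-free set `P`.
  set K : Set ℂ := range γ ∪ (fun y => -y) '' range γ with hK
  have hγc : IsCompact (range γ) := isCompact_range γ.continuous
  have hγconn : IsConnected (range γ) := isConnected_range γ.continuous
  have hKc : IsCompact K := hγc.union (hγc.image continuous_neg)
  have hγP : range γ ⊆ P := by rintro _ ⟨t, rfl⟩; exact hγ t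
  have hKP : K ⊆ P := by
    rintro y (hy | ⟨y, hy, rfl⟩)
    · exact hγP hy
    · exact hPneg _ (hγP hy)
  have hKconn : IsConnected K := by
    refine hγconn.union ⟨φ x, ⟨0, by simp⟩, -φ x, ⟨1, by simp⟩, by simp⟩
      (hγconn.image _ continuousOn_neg)
  have hnh : NoHoles P := by
    refine NoHoles.connectedComponentIn ?_ hEo _
    exact (noHoles_quadCutDomain S.zero_mem S.level.pos (φ α)).preimage_quad_iterate
      (isOpen_quadCutDomain c (φ α) h) (m + 1)
  have hlog := hnh.hasLogOn_sub hPo hKc hKP h0P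
  simp only [sub_zero] at hlog
  refine not_hasLogOn_id_of_symmetric hKconn ?_ hlog
  rintro y (hy | ⟨y, hy, rfl⟩)
  · exact Or.inr ⟨y, hy, rfl⟩
  · rw [neg_neg]; exact Or.inl hy

theorem injOn_iterate_component {m k : ℕ} {z : ℂ}
    (hz : z ∈ iteratePreimage f U' (m + k) (cutDomain c φ α h))
    (h0 : ∀ j < k, ∀ x ∈ connectedComponentIn (iteratePreimage f U' (m + k) (cutDomain c φ α h)) z,
      f^[j] x ≠ 0) :
    InjOn f^[k] (connectedComponentIn (iteratePreimage f U' (m + k) (cutDomain c φ α h)) z) := by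
  induction k generalizing z with
  | zero => exact injOn_id _
  | succ k ih =>
    rw [← add_assoc] at hz h0 ⊢
    have hfz : f z ∈ iteratePreimage f U' (m + k) (cutDomain c φ α h) := by
      rw [iteratePreimage_succ] at hz; exact hz.2
    rw [Function.iterate_succ]
    refine (ih hfz fun j hj y hy => ?_).comp
      (S.injOn_component fun hmem => h0 0 k.succ_pos 0 hmem rfl) (S.mapsTo_component hz)
    rw [← S.image_component hz] at hy
    obtain ⟨x, hx, rfl⟩ := hy
    exact h0 (j + 1) (by omega) x hx

/-- The iterate that carries a piece onto another one carries its closure onto the closure. -/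
theorem image_iterate_closure_component {m k : ℕ} {z : ℂ}
    (hz : z ∈ iteratePreimage f U' (m + k) (cutDomain c φ α h)) :
    f^[k] '' closure
        (connectedComponentIn (iteratePreimage f U' (m + k) (cutDomain c φ α h)) z) =
      closure (connectedComponentIn (iteratePreimage f U' m (cutDomain c φ α h)) (f^[k] z)) := by
  set P := connectedComponentIn (iteratePreimage f U' (m + k) (cutDomain c φ α h)) z with hP
  -- the closed disks bounded by equipotentials
  set X : ℝ → Set ℂ := fun t => φ.symm '' {y | green c y ≤ t} with hX
  have hXc : ∀ t ≤ h, IsCompact (X t) := fun t ht =>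
    (isCompact_green_le c t).image_of_continuousOn
      (φ.continuousOn_symm.mono fun y hy => S.mem_target (le_trans hy ht))
  have hXU : ∀ t ≤ h, X t ⊆ U' := by
    rintro t ht _ ⟨y, hy, rfl⟩
    exact S.source_subset_dom (φ.map_target (S.mem_target (le_trans hy ht)))
  have hXf : ∀ t, ∀ k : ℕ, 2 ^ k * t ≤ h → 0 ≤ t → ∀ x ∈ X t, ∀ j ≤ k, f^[j] x ∈ U' := by
    intro t k hk ht
    induction k generalizing t with
    | zero =>
      intro x hx j hj
      obtain rfl : j = 0 := by omega
      exact hXU t (by simpa using hk) hx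
    | succ k ih =>
      intro x hx j hj
      have hth : t ≤ h := by
        have : (1 : ℝ) ≤ 2 ^ (k + 1) := one_le_pow₀ one_le_two
        nlinarith
      rcases j with _ | j
      · exact hXU t hth hx
      · refine ih (2 * t) (by rw [pow_succ] at hk; linarith) (by linarith) (f x) ?_ j (by omega)
        obtain ⟨y, hy, rfl⟩ := hx
        have h1 := S.apply_symm (le_trans hy hth)
        refine ⟨quad c y, ?_, by rw [← h1.2, φ.left_inv h1.1]⟩
        rw [mem_ofPred_eq, green_quad]
        linarith [show green c y ≤ t from hy]
  -- The piece has potential below h / 2^(m+k), so its closure lies in the closed disk of that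
  -- level. The first k iterates of this disk stay in U', which makes f^k continuous on the compact
  -- closure.
  set t := h / 2 ^ (m + k) with ht
  have ht0 : 0 ≤ t := div_nonneg S.level.pos.le (by positivity)
  have htk : 2 ^ k * t ≤ h := by
    rw [ht, pow_add, mul_div_assoc', div_le_iff₀ (by positivity)]
    have : (1 : ℝ) ≤ 2 ^ m := one_le_pow₀ one_le_two
    have h2 : (0 : ℝ) < 2 ^ k := by positivity
    nlinarith [S.level.pos, mul_pos S.level.pos h2]
  have hth : t ≤ h := by
    have : (1 : ℝ) ≤ 2 ^ k := one_le_pow₀ one_le_two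
    nlinarith
  have hPX : P ⊆ X t := by
    intro x hx
    have := connectedComponentIn_subset _ _ hx
    rw [S.iteratePreimage_eq] at this
    refine ⟨φ x, ?_, φ.left_inv this.1⟩
    have h1 := this.2.1
    rw [green_quad_iterate] at h1
    rw [mem_ofPred_eq, ht, le_div_iff₀ (by positivity)]
    linarith
  have hclX : closure P ⊆ X t := closure_minimal hPX (hXc t hth).isClosed
  have hcont : ContinuousOn f^[k] (closure P) := fun x hx =>
    (S.quadLike.deriv_iterate fun j hj =>
      hXf t k htk ht0 x (hclX hx) j hj.le).1.continuousAt.continuousWithinAt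
  have himg : f^[k] '' P =
      connectedComponentIn (iteratePreimage f U' m (cutDomain c φ α h)) (f^[k] z) :=
    S.image_iterate_component hz
  rw [← himg]
  refine Subset.antisymm hcont.image_closure (closure_minimal (image_mono subset_closure) ?_)
  exact (((hXc t hth).of_isClosed_subset isClosed_closure hclX).image_of_continuousOn
    hcont).isClosed

end IsPuzzleSetting

namespace IsPuzzleSetting

variable {f : ℂ → ℂ} {U' U : Set ℂ} {c : ℂ} {φ : OpenPartialHomeomorph ℂ ℂ} {α : ℂ} {h : ℝ}
  (S : IsPuzzleSetting f U' U c φ α h) {n : ℕ} {V : Set ℂ}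
  (hV : V = connectedComponentIn (iteratePreimage f U' n (cutDomain c φ α h)) 0)

/-! ### The first return map to a critical piece -/

include hV in
theorem mem_iteratePreimage_of_mem_returnTimes {z : ℂ} {l : ℕ} (hl : l ∈ returnTimes f U' V z) :
    z ∈ iteratePreimage f U' (n + l) (cutDomain c φ α h) := by
  rw [iteratePreimage_add]
  refine ⟨hl.2.1, connectedComponentIn_subset _ 0 ?_⟩
  rw [← hV]
  exact hl.2.2

theorem returnTime_mem {z : ℂ} (hz : z ∈ returnSet f U' V) :
    returnTime f U' V z ∈ returnTimes f U' V z :=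
  Nat.sInf_mem hz.2

include S hV

theorem image_component_eq_of_mem_returnTimes {z : ℂ} {l : ℕ} (hl : l ∈ returnTimes f U' V z) :
    f^[l] '' connectedComponentIn (iteratePreimage f U' (n + l) (cutDomain c φ α h)) z = V := by
  rw [S.image_iterate_component (mem_iteratePreimage_of_mem_returnTimes hV hl), hV]
  refine (connectedComponentIn_eq ?_).symm
  rw [← hV]
  exact hl.2.2

/-- The piece of depth `n + l` around a point with return time `l` lies in `V` and consists of
points with return time `l`. -/
theorem component_subset {z : ℂ} (hz : z ∈ returnSet f U' V) :
    ∀ x ∈ connectedComponentIn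
      (iteratePreimage f U' (n + returnTime f U' V z) (cutDomain c φ α h)) z,
      x ∈ V ∧ returnTime f U' V x = returnTime f U' V z ∧
        returnTime f U' V z ∈ returnTimes f U' V x := by
  intro x hx
  have hl := returnTime_mem hz
  set l := returnTime f U' V z with hldef
  have hzD := mem_iteratePreimage_of_mem_returnTimes hV hl
  have hxD := connectedComponentIn_subset _ _ hx
  have hxV : x ∈ V := by
    have h1 := connectedComponentIn_mono z (S.antitone_iteratePreimage (Nat.le_add_right n l)) hx
    have hzV := hz.1
    rw [hV] at hzV ⊢
    rwa [connectedComponentIn_eq hzV]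
  have hxl : l ∈ returnTimes f U' V x := by
    refine ⟨hl.1, ?_, ?_⟩
    · rw [iteratePreimage_add] at hxD
      exact hxD.1
    · rw [← S.image_component_eq_of_mem_returnTimes hV hl]
      exact mem_image_of_mem _ hx
  -- If x returned at a time k < l, then f^k x and f^k z would share a component of depth n + (l -
  -- k), contained in one of depth n, namely V. So z would return at time k as well.
  refine ⟨hxV, le_antisymm (Nat.sInf_le hxl) ?_, hxl⟩
  by_contra! hlt
  have hk := Nat.sInf_mem ⟨l, hxl⟩
  rw [← returnTime] at hk
  set k := returnTime f U' V x with hkdef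
  refine absurd (Nat.sInf_le (?_ : k ∈ returnTimes f U' V z)) (not_le.2 hlt)
  refine ⟨hk.1, fun j hj => hl.2.1 j (hj.trans hlt), ?_⟩
  have hsum : n + l = (n + (l - k)) + k := by omega
  rw [hsum] at hx hzD
  have himg := S.image_iterate_component hzD
  have h1 : f^[k] x ∈ connectedComponentIn
      (iteratePreimage f U' (n + (l - k)) (cutDomain c φ α h)) (f^[k] z) := by
    rw [← himg]; exact mem_image_of_mem _ hx
  have h2 := connectedComponentIn_mono (f^[k] z)
    (S.antitone_iteratePreimage (Nat.le_add_right n (l - k))) h1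
  have hkV := hk.2.2
  rw [hV] at hkV ⊢
  rw [connectedComponentIn_eq hkV, ← connectedComponentIn_eq h2]
  refine mem_connectedComponentIn (connectedComponentIn_nonempty_iff.1 ⟨_, h2⟩)

/-- The domains of the first return map are pieces. -/
theorem connectedComponentIn_returnSet {z : ℂ} (hz : z ∈ returnSet f U' V) :
    connectedComponentIn (returnSet f U' V) z = connectedComponentIn
      (iteratePreimage f U' (n + returnTime f U' V z) (cutDomain c φ α h)) z := by
  have hmem : ∀ {y}, y ∈ returnSet f U' V → y ∈ iteratePreimage f U' (n + returnTime f U' V y)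
      (cutDomain c φ α h) := fun hy =>
    mem_iteratePreimage_of_mem_returnTimes hV (returnTime_mem hy)
  have hsub : ∀ {y}, y ∈ returnSet f U' V → connectedComponentIn
      (iteratePreimage f U' (n + returnTime f U' V y) (cutDomain c φ α h)) y ⊆
        returnSet f U' V := fun hy x hx =>
    ⟨(S.component_subset hV hy x hx).1, _, (S.component_subset hV hy x hx).2.2⟩
  refine Subset.antisymm ?_ (isPreconnected_connectedComponentIn.subset_connectedComponentIn
    (mem_connectedComponentIn (hmem hz)) (hsub hz))
  set P := connectedComponentIn
    (iteratePreimage f U' (n + returnTime f U' V z) (cutDomain c φ α h)) z with hP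
  have hPo : IsOpen P := (S.isOpen_iteratePreimage _).connectedComponentIn
  -- The rest of the return set is a union of pieces of the same kind: two such pieces that meet
  -- have the same return time, hence the same depth, hence coincide.
  have hrest : IsOpen (returnSet f U' V \ P) := by
    rw [isOpen_iff_mem_nhds]
    intro y hy
    filter_upwards [(S.isOpen_iteratePreimage _).connectedComponentIn.mem_nhds
      (mem_connectedComponentIn (hmem hy.1))] with x hx
    refine ⟨hsub hy.1 hx, fun hxP => hy.2 ?_⟩
    have h1 := (S.component_subset hV hy.1 x hx).2.1
    rw [(S.component_subset hV hz x hxP).2.1] at h1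
    rw [hP, connectedComponentIn_eq hxP, h1, ← connectedComponentIn_eq hx]
    exact mem_connectedComponentIn (hmem hy.1)
  refine isPreconnected_connectedComponentIn.subset_left_of_subset_union hPo hrest
    disjoint_sdiff_right ?_ ⟨z, mem_connectedComponentIn hz, mem_connectedComponentIn (hmem hz)⟩
  rw [union_sdiff_self]
  exact (connectedComponentIn_subset _ _).trans subset_union_right

/-- A domain of the first return map, as a piece. -/
theorem exists_of_isReturnDomain {W : Set ℂ} (hW : IsReturnDomain f U' V W) :
    ∃ (z : ℂ) (l : ℕ), 0 < l ∧ z ∈ iteratePreimage f U' (n + l) (cutDomain c φ α h) ∧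
      W = connectedComponentIn (iteratePreimage f U' (n + l) (cutDomain c φ α h)) z ∧
      W ⊆ V ∧ V = connectedComponentIn (iteratePreimage f U' n (cutDomain c φ α h)) (f^[l] z) ∧
      (∀ x ∈ W, returnTime f U' V x = l) ∧ (∀ x ∈ W, l ∈ returnTimes f U' V x) := by
  obtain ⟨z, hz, rfl⟩ := hW
  have hl := returnTime_mem hz
  rw [S.connectedComponentIn_returnSet hV hz]
  refine ⟨z, _, hl.1, mem_iteratePreimage_of_mem_returnTimes hV hl, rfl,
    fun x hx => (S.component_subset hV hz x hx).1, ?_,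
    fun x hx => (S.component_subset hV hz x hx).2.1,
    fun x hx => (S.component_subset hV hz x hx).2.2⟩
  have hlV := hl.2.2
  rw [hV] at hlV ⊢
  exact connectedComponentIn_eq hlV

omit S hV in
-- Since 0 ∈ V, a visit to the critical point is a visit to V. Hence 0 is the only critical point
-- that the return map can have.
theorem iterate_ne_zero_of_lt_returnTime (h0V : (0 : ℂ) ∈ V) {x : ℂ} {l j : ℕ}
    (hl : returnTime f U' V x = l) (hlx : l ∈ returnTimes f U' V x) (hj : 0 < j) (hjl : j < l) :
    f^[j] x ≠ 0 := by
  intro h0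
  have : j ∈ returnTimes f U' V x := ⟨hj, fun k hk => hlx.2.1 k (hk.trans hjl), h0 ▸ h0V⟩
  exact absurd (Nat.sInf_le this) (not_le.2 (lt_of_lt_of_eq hjl hl.symm))

theorem isBranchedCovering_returnMap {W : Set ℂ} (hW : IsReturnDomain f U' V W) :
    IsBranchedCovering (returnMap f U' V) W V := by
  obtain ⟨z, l, -, hzD, hWeq, -, hVeq, htime, htimes⟩ := S.exists_of_isReturnDomain hV hW
  have hr : ∀ x ∈ W, returnMap f U' V x = f^[l] x := fun x hx => by
    rw [returnMap, htime x hx]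
  have himg : f^[l] '' W = V := by
    rw [hWeq, hVeq]; exact S.image_iterate_component hzD
  refine ⟨?_, fun x hx => ?_, ?_, fun C hC hCc => ?_⟩
  · refine DifferentiableOn.congr (fun x hx => ?_) hr
    exact (S.quadLike.deriv_iterate (htimes x hx).2.1).1.differentiableWithinAt
  · rw [hr x hx, ← himg]
    exact mem_image_of_mem _ hx
  · intro v hv
    rw [← himg] at hv
    obtain ⟨x, hx, rfl⟩ := hv
    exact ⟨x, hx, hr x hx⟩
  · have : W ∩ returnMap f U' V ⁻¹' C = W ∩ f^[l] ⁻¹' C := by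
      ext x
      simp only [mem_inter_iff, mem_preimage]
      exact and_congr_right fun hx => by rw [hr x hx]
    rw [this, hWeq]
    exact S.isCompact_component_inter_preimage_iterate hzD hCc (hVeq ▸ hC)

theorem isUnivalentOnto_returnMap (h0V : (0 : ℂ) ∈ V) {W : Set ℂ} (hW : IsReturnDomain f U' V W)
    (h0 : (0 : ℂ) ∉ W) : IsUnivalentOnto (returnMap f U' V) W V := by
  have hcov := S.isBranchedCovering_returnMap hV hW
  refine ⟨hcov.holo, hcov.mapsTo, ?_, hcov.surjOn⟩
  obtain ⟨z, l, -, hzD, hWeq, -, -, htime, htimes⟩ := S.exists_of_isReturnDomain hV hW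
  have hinj : InjOn f^[l] W := by
    rw [hWeq]
    refine S.injOn_iterate_component hzD fun j hj x hx => ?_
    rw [← hWeq] at hx
    rcases j.eq_zero_or_pos with rfl | hj0
    · rintro rfl
      exact h0 hx
    · exact iterate_ne_zero_of_lt_returnTime h0V (htime x hx) (htimes x hx) hj0 hj
  refine hinj.congr fun x hx => ?_
  rw [returnMap, htime x hx]

theorem isDoubleBranchedCovering_returnMap (h0V : (0 : ℂ) ∈ V) {W : Set ℂ}
    (hW : IsReturnDomain f U' V W) (h0 : (0 : ℂ) ∈ W) :
    IsDoubleBranchedCovering (returnMap f U' V) W V 0 := by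
  have hcov := S.isBranchedCovering_returnMap hV hW
  obtain ⟨z, l, hl, hzD, hWeq, -, -, htime, htimes⟩ := S.exists_of_isReturnDomain hV hW
  have hWo : IsOpen W := hWeq ▸ (S.isOpen_iteratePreimage _).connectedComponentIn
  obtain ⟨k, rfl⟩ := Nat.exists_eq_succ_of_ne_zero hl.ne'
  have hr : ∀ x ∈ W, returnMap f U' V x = f^[k] (f x) := fun x hx => by
    rw [returnMap, htime x hx, Function.iterate_succ_apply]
  have hne : ∀ x ∈ W, ∀ j, 0 < j → j < k + 1 → f^[j] x ≠ 0 := fun x hx j hj hjk =>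
    iterate_ne_zero_of_lt_returnTime h0V (htime x hx) (htimes x hx) hj hjk
  have hWU : W ⊆ U' := fun x hx => (htimes x hx).2.1 0 hl
  -- the first iterate covers the image twice, the remaining ones are injective
  have h0D : (0 : ℂ) ∈ iteratePreimage f U' (n + k + 1) (cutDomain c φ α h) :=
    connectedComponentIn_subset _ _ (hWeq ▸ h0)
  have hW0 : W = connectedComponentIn (iteratePreimage f U' (n + k + 1) (cutDomain c φ α h)) 0 := by
    rw [hWeq]; exact connectedComponentIn_eq (hWeq ▸ h0)
  have himg : f '' W =
      connectedComponentIn (iteratePreimage f U' (n + k) (cutDomain c φ α h)) (f 0) := by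
    rw [hW0]; exact S.image_component h0D
  have hinj : InjOn f^[k] (f '' W) := by
    rw [himg]
    have hf0D : f 0 ∈ iteratePreimage f U' (n + k) (cutDomain c φ α h) := by
      rw [iteratePreimage_succ] at h0D; exact h0D.2
    refine S.injOn_iterate_component hf0D fun j hj y hy => ?_
    rw [← himg] at hy
    obtain ⟨x, hx, rfl⟩ := hy
    exact hne x hx (j + 1) j.succ_pos (by omega)
  -- Any component of the preimage of `f '' W` maps onto it and so contains a preimage of f 0. The
  -- only one is 0, so this component is W, and fibers over `f '' W` are full fibers of f.
  have hfull : ∀ x ∈ U', f x ∈ f '' W → x ∈ W := by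
    intro x hx hfx
    have hxD : x ∈ iteratePreimage f U' (n + k + 1) (cutDomain c φ α h) := by
      rw [iteratePreimage_succ]
      rw [himg] at hfx
      exact ⟨hx, mem_preimage.2 (connectedComponentIn_subset _ _ hfx)⟩
    have h1 := S.image_component hxD
    rw [himg] at hfx
    rw [← connectedComponentIn_eq hfx] at h1
    have h2 : f 0 ∈ connectedComponentIn (iteratePreimage f U' (n + k) (cutDomain c φ α h)) (f 0) :=
      mem_connectedComponentIn (connectedComponentIn_nonempty_iff.1 ⟨_, hfx⟩)
    rw [← h1] at h2
    obtain ⟨y, hy, hy0⟩ := h2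
    have hyU : y ∈ U' := S.source_subset_dom
      (S.iteratePreimage_subset_source _ (connectedComponentIn_subset _ _ hy))
    obtain rfl := S.quadLike.eq_zero_of_apply_eq hyU hy0
    rw [hW0, ← connectedComponentIn_eq hy]
    exact mem_connectedComponentIn hxD
  have hfib : ∀ x₀ ∈ W, W ∩ returnMap f U' V ⁻¹' {returnMap f U' V x₀} = U' ∩ f ⁻¹' {f x₀} := by
    intro x₀ hx₀
    ext x
    constructor
    · rintro ⟨hx, hxe⟩
      rw [mem_preimage, mem_singleton_iff, hr x hx, hr x₀ hx₀] at hxe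
      exact ⟨hWU hx, hinj ⟨x, hx, rfl⟩ ⟨x₀, hx₀, rfl⟩ hxe⟩
    · rintro ⟨hx, hxe⟩
      rw [mem_preimage, mem_singleton_iff] at hxe
      have hxW : x ∈ W := hfull x hx ⟨x₀, hx₀, hxe.symm⟩
      refine ⟨hxW, ?_⟩
      rw [mem_preimage, mem_singleton_iff, hr x hxW, hr x₀ hx₀, hxe]
  refine ⟨hcov, h0, fun x hx => ?_, ?_, fun w hw hw0 => ?_⟩
  · have hev : returnMap f U' V =ᶠ[𝓝 x] f^[k + 1] := by
      filter_upwards [hWo.mem_nhds hx] with y hy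
      rw [returnMap, htime y hy]
    rw [hev.deriv_eq, (S.quadLike.deriv_iterate (htimes x hx).2.1).2]
    constructor
    · rintro ⟨j, hj, hj0⟩
      rcases j.eq_zero_or_pos with rfl | hjpos
      · exact hj0
      · exact absurd hj0 (hne x hx j hjpos hj)
    · intro hx0
      exact ⟨0, hl, hx0⟩
  · rw [hfib 0 h0, S.quadLike.covering.fiber_critical]
  · obtain ⟨x₀, hx₀, rfl⟩ := hcov.surjOn hw
    rw [hfib x₀ hx₀]
    refine S.quadLike.covering.fiber _ (S.quadLike.covering.mapsTo (hWU hx₀)) fun he => hw0 ?_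
    rw [hr x₀ hx₀, hr 0 h0, he]

omit S hV in
/-- Distinct components of a set are disjoint. -/
theorem pairwiseDisjoint_components (T : Set ℂ) :
    {P | IsComponentOf P T}.PairwiseDisjoint id := by
  rintro _ ⟨x, -, rfl⟩ _ ⟨y, -, rfl⟩ hne
  rw [Function.onFun, id, id, disjoint_left]
  intro w hx hy
  exact hne ((connectedComponentIn_eq hx).trans (connectedComponentIn_eq hy).symm)

/-- The first return map, restricted to any family of its domains, is Bernoulli. -/
theorem isBernoulli_returnMap {F : Set (Set ℂ)} (hF : ∀ W ∈ F, IsReturnDomain f U' V W) :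
    IsBernoulli (returnMap f U' V) F V := by
  have hdisk : ∀ W ∈ F, IsTopologicalDisk W := fun W hW => by
    obtain ⟨z, l, -, hzD, rfl, -⟩ := S.exists_of_isReturnDomain hV (hF W hW)
    exact S.isTopologicalDisk_component hzD
  have hsub : ∀ W ∈ F, W ⊆ V := fun W hW => by
    obtain ⟨z, l, -, -, -, h1, -⟩ := S.exists_of_isReturnDomain hV (hF W hW)
    exact h1
  have hdisj : F.PairwiseDisjoint id := (pairwiseDisjoint_components _).subset hF
  have himg : ∀ W ∈ F, returnMap f U' V '' W = V := fun W hW =>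
    have hcov := S.isBranchedCovering_returnMap hV (hF W hW)
    hcov.surjOn.image_eq_of_mapsTo hcov.mapsTo
  refine ⟨⟨?_, hdisk, hdisj, fun W hW => ?_, fun P hP Q hQ _ => ?_⟩, fun P hP => ?_, hsub⟩
  -- Disjoint nonempty open sets in a separable space are countable in number. The Markov condition
  -- is immediate because every domain has image V.
  · exact hdisj.countable_of_isOpen (fun W hW => (hdisk W hW).isOpen)
      (fun W hW => (hdisk W hW).isConnected.nonempty)
  · rw [himg W hW]
    exact S.isBranchedCovering_returnMap hV (hF W hW)
  · rw [himg P hP]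
    exact hsub Q hQ
  · rw [himg P hP]

end IsPuzzleSetting

end Puzzle

theorem lemma3p4
    (f : ℂ → ℂ) (U' U : Set ℂ) (hf : IsQuadraticLike f U' U)
    (hK : IsConnected (filledJulia f U')) (hrep : FixedPointsRepelling f U')
    (c : ℂ) (φ : OpenPartialHomeomorph ℂ ℂ) (hφ : IsConjugacy f U' c φ)
    (α : ℂ) (hα : IsDividingFixedPoint f U' α)
    (h : ℝ) (hh : IsAdmissibleLevel f c φ h)
    (n : ℕ) (V : Set ℂ) (hV : IsPuzzlePiece f U' c φ α h n V) (hcrit : (0 : ℂ) ∈ V) :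
    (∀ W, IsReturnDomain f U' V W →
      W ⊆ V ∧
      (∃ l : ℕ, 0 < l ∧ IsPuzzlePiece f U' c φ α h (n + l) W ∧
        (∀ z ∈ W, returnTime f U' V z = l) ∧ f^[l] '' closure W = closure V) ∧
      ((0 : ℂ) ∉ W → IsUnivalentOnto (returnMap f U' V) W V) ∧
      ((0 : ℂ) ∈ W → IsDoubleBranchedCovering (returnMap f U' V) W V 0)) ∧
    IsBernoulli (returnMap f U' V) {W | IsReturnDomain f U' V W} V ∧
    IsStandardBernoulli (returnMap f U' V) {W | IsReturnDomain f U' V W ∧ (0 : ℂ) ∉ W} V := by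
  have S : IsPuzzleSetting f U' U c φ α h := ⟨hf, hK, hφ, hα.mem, hα.fixed, hh⟩
  obtain ⟨v, -, hVv⟩ := hV
  -- The critical point serves as the base point of V from here on.
  have hV0 : V = connectedComponentIn (iteratePreimage f U' n (cutDomain c φ α h)) 0 := by
    rw [hVv]; exact connectedComponentIn_eq (hVv ▸ hcrit)
  refine ⟨fun W hW => ⟨?_, ?_, S.isUnivalentOnto_returnMap hV0 hcrit hW,
    S.isDoubleBranchedCovering_returnMap hV0 hcrit hW⟩,
    S.isBernoulli_returnMap hV0 fun W hW => hW,
    S.isBernoulli_returnMap hV0 fun W hW => hW.1,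
    fun W hW => (S.isUnivalentOnto_returnMap hV0 hcrit hW.1 hW.2).bij.injOn⟩
  · obtain ⟨z, l, -, -, -, hsub, -⟩ := S.exists_of_isReturnDomain hV0 hW
    exact hsub
  · obtain ⟨z, l, hl, hzD, hWeq, -, hVeq, htime, -⟩ := S.exists_of_isReturnDomain hV0 hW
    refine ⟨l, hl, ⟨z, hzD, hWeq⟩, htime, ?_⟩
    rw [hWeq, S.image_iterate_closure_component hzD, ← hVeq]
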